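/- Let $k$ be a field of characteristic $0$ and $n\ge 1$. For an associative ring $A$ with a derivation $d$, let $A((\partial^{-1}))$ be the ring of formal pseudo-differential operators $\sum_{i\le N}a_i\partial^i$ ($a_i\in A$, $N \in \mathbb{Z}$) with the multiplication $$\Big(\sum_i a_i\partial^i\Big)\Big(\sum_j b_j\partial^j\Big)=\sum_{i,j;\,m\ge 0}\binom{i}{m}a_i\,d^m(b_j)\,\partial^{i+j-m}.$$ Let $E=k[[x_1,\dots,x_n]]((\partial_1^{-1}))\cdots((\partial_n^{-1}))$ be the ring obtained by iterating this construction, where at the $i$-th step the derivation is $\partial/\partial x_i$, extended coefficientwise. Let $E_-\subset E$ be the set of operators that contain only negative powers of $\partial_n$. Let $L_1,\dots,L_n\in E$ with $L_i\in\partial_i+E_-$ for all $i$ and $[L_i,L_j]=0$ for all $i,j$. Then the ring $Z(L_1,\dots,L_n)\subset E$ of all operators in $E$ that commute with every $L_i$ is commutative and equals $k((L_1^{-1}))\cdots((L_n^{-1}))$. That is: every $L_i$ is invertible in $E$; for every iterated Laurent series $c=\sum_\alpha c_\alpha z^\alpha\in k((z_1))\cdots((z_n))$ the series $\sum_\alpha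 c_\alpha L_1^{-\alpha_1}\cdots L_n^{-\alpha_n}$ converges in $E$ coefficientwise (for each $\beta\in\mathbb{Z}^n$, only finitely many terms have a nonzero coefficient at $\partial_1^{\beta_1}\cdots\partial_n^{\beta_n}$, and the resulting coefficients are those of an element of $E$); the map sending $c$ to this sum is a ring homomorphism $k((z_1))\cdots((z_n))\to E$; and $Z(L_1,\dots,L_n)$ is the set of all these sums. -/

import Mathlib

universe u v

/-- A derivation of an associative (not necessarily commutative) ring. -/
structure RingDer (A : Type u) [Ring A] extends A →+ A where
  leibniz' : ∀ a b : A, toFun (a * b) = toFun a * b + a * toFun b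

namespace RingDer

variable {A : Type u} [Ring A]

instance : FunLike (RingDer A) A A where
  coe d := d.toFun
  coe_injective d e h := by
    cases d; cases e; congr; exact DFunLike.coe_injective h

instance : AddMonoidHomClass (RingDer A) A A where
  map_add d := d.map_add'
  map_zero d := d.map_zero'

theorem leibniz (d : RingDer A) (a b : A) : d (a * b) = d a * b + a * d b := d.leibniz' a b

theorem iter_add (d : RingDer A) (k : ℕ) (a b : A) : d^[k] (a + b) = d^[k] a + d^[k] b :=
  iterate_map_add d k a b

theorem iter_zero (d : RingDer A) (k : ℕ) : d^[k] (0 : A) = 0 := iterate_map_zero d k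

theorem iter_zsmul (d : RingDer A) (k : ℕ) (n : ℤ) (a : A) : d^[k] (n • a) = n • d^[k] a :=
  by
  induction k with
  | zero => rfl
  | succ k ih => rw [Function.iterate_succ_apply', ih, map_zsmul, Function.iterate_succ_apply']

theorem map_one (d : RingDer A) : d 1 = 0 := by
  have h := d.leibniz 1 1
  simpa using h

theorem iter_leibniz (d : RingDer A) (q : ℕ) (a b : A) :
    d^[q] (a * b) = ∑ p ∈ Finset.HasAntidiagonal.antidiagonal q, q.choose p.1 • (d^[p.1] a * d^[p.2] b) := by
  induction q with
  | zero => simp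
  | succ q ih =>
    rw [Function.iterate_succ_apply', ih, map_sum,
      Finset.sum_antidiagonal_choose_succ_nsmul (fun i j => d^[i] a * d^[j] b),
      ← Finset.sum_add_distrib]
    refine Finset.sum_congr rfl fun p hp => ?_
    have h2 : q.choose p.2 = q.choose p.1 :=
      Nat.choose_symm_of_eq_add (by rw [Finset.HasAntidiagonal.mem_antidiagonal] at hp; omega)
    rw [map_nsmul, leibniz, h2, ← smul_add, Function.iterate_succ_apply',
      Function.iterate_succ_apply', add_comm]

end RingDer

/-- The two-sided sequences `(a_i)` that vanish for all large `i`, i.e. the coefficients of the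
formal expressions `∑_{i ≤ N} a_i ∂ ^ i`. -/
def boundedAbove (A : Type u) [Ring A] : AddSubgroup (ℤ → A) where
  carrier := {f | ∃ N : ℤ, ∀ i, N < i → f i = 0}
  zero_mem' := ⟨0, fun _ _ => rfl⟩
  add_mem' := by
    rintro f g ⟨N, hN⟩ ⟨M, hM⟩
    refine ⟨max N M, fun i hi => ?_⟩
    simp [hN i (lt_of_le_of_lt (le_max_left _ _) hi), hM i (lt_of_le_of_lt (le_max_right _ _) hi)]
  neg_mem' := by
    rintro f ⟨N, hN⟩
    exact ⟨N, fun i hi => by simp [hN i hi]⟩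

/-- The ring `A((∂⁻¹))` of formal pseudo-differential operators `∑_{i ≤ N} a_i ∂ ^ i` with
coefficients in `A`, where `∂` acts on `A` as the derivation `d`. -/
def PsDO {A : Type u} [Ring A] (_d : RingDer A) : Type u := boundedAbove A

theorem finsum_eq_comp {α β M : Type*} [AddCommMonoid M] (F : β → M) (e : α → β)
    (he : Function.Injective e) (h : ∀ b, b ∉ Set.range e → F b = 0) :
    ∑ᶠ b, F b = ∑ᶠ a, F (e a) := by
  classical
  rw [← finsum_mem_range he]
  refine finsum_congr fun b => ?_
  by_cases hb : b ∈ Set.range e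
  · exact (finsum_eq_if.trans (if_pos hb)).symm
  · rw [h b hb]; exact (finsum_eq_if.trans (if_neg hb)).symm

namespace PsDO

variable {A : Type u} [Ring A] {d : RingDer A}

noncomputable instance : AddCommGroup (PsDO d) := inferInstanceAs (AddCommGroup (boundedAbove A))

/-- The coefficient of `∂ ^ i`. -/
def coeff (f : PsDO d) (i : ℤ) : A := f.1 i

/-- The operator with given coefficients. -/
def ofCoeff (f : ℤ → A) (h : ∃ N : ℤ, ∀ i, N < i → f i = 0) : PsDO d := ⟨f, h⟩

@[simp] theorem coeff_ofCoeff (f : ℤ → A) (h : ∃ N : ℤ, ∀ i, N < i → f i = 0) (i : ℤ) :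
    (ofCoeff f h : PsDO d).coeff i = f i := rfl

theorem bdd (f : PsDO d) : ∃ N : ℤ, ∀ i, N < i → f.coeff i = 0 := f.2

@[ext] theorem ext {f g : PsDO d} (h : ∀ i, f.coeff i = g.coeff i) : f = g :=
  Subtype.ext (funext h)

@[simp] theorem coeff_zero (i : ℤ) : (0 : PsDO d).coeff i = 0 := rfl

@[simp] theorem coeff_add (f g : PsDO d) (i : ℤ) : (f + g).coeff i = f.coeff i + g.coeff i := rfl

@[simp] theorem coeff_neg (f : PsDO d) (i : ℤ) : (-f).coeff i = -f.coeff i := rfl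

@[simp] theorem coeff_sub (f g : PsDO d) (i : ℤ) : (f - g).coeff i = f.coeff i - g.coeff i := rfl

/-- The operator `a ∂ ^ i`. -/
noncomputable def single (i : ℤ) (a : A) : PsDO d :=
  ofCoeff (fun j => if j = i then a else 0) ⟨i, fun _ hj => if_neg hj.ne'⟩

theorem coeff_single (i : ℤ) (a : A) (j : ℤ) :
    (single i a : PsDO d).coeff j = if j = i then a else 0 := rfl

/-- The coefficient of `∂ ^ n` in
`(∑ a_i ∂ ^ i) (∑ b_j ∂ ^ j) = ∑_{i, j, k ≥ 0} (i choose k) a_i d ^ k (b_j) ∂ ^ (i + j - k)`.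
The sum is over the pairs `(i, k)`, and `j = n - i + k`; it has only finitely many nonzero terms. -/
noncomputable def mulCoeff (f g : PsDO d) (n : ℤ) : A :=
  ∑ᶠ p : ℤ × ℕ, Ring.choose p.1 p.2 • (f.coeff p.1 * d^[p.2] (g.coeff (n - p.1 + p.2)))

theorem mul_support (f g : PsDO d) (n : ℤ) :
    (Function.support fun p : ℤ × ℕ =>
      Ring.choose p.1 p.2 • (f.coeff p.1 * d^[p.2] (g.coeff (n - p.1 + p.2)))).Finite := by
  obtain ⟨N, hN⟩ := f.bdd
  obtain ⟨M, hM⟩ := g.bdd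
  refine ((Finset.Icc (n - M) N) ×ˢ (Finset.range (M - n + N + 1).toNat)).finite_toSet.subset ?_
  intro p hp
  have h1 : p.1 ≤ N := by
    by_contra h
    exact hp (by simp [hN p.1 (not_le.mp h)])
  have h2 : n - p.1 + p.2 ≤ M := by
    by_contra h
    exact hp (by simp [hM _ (not_le.mp h)])
  simp only [Finset.coe_product, Set.mem_prod, Finset.coe_Icc, Set.mem_Icc, Finset.coe_range,
    Set.mem_Iio]
  omega

theorem mulCoeff_of_lt {f g : PsDO d} {N M : ℤ} (hN : ∀ i, N < i → f.coeff i = 0)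
    (hM : ∀ i, M < i → g.coeff i = 0) {n : ℤ} (hn : N + M < n) : mulCoeff f g n = 0 := by
  refine finsum_eq_zero_of_forall_eq_zero fun p => ?_
  by_cases h : N < p.1
  · simp [hN _ h]
  · rw [hM (n - p.1 + p.2) (by omega), RingDer.iter_zero]
    simp

noncomputable instance : Mul (PsDO d) where
  mul f g := ofCoeff (mulCoeff f g) (by
    obtain ⟨N, hN⟩ := f.bdd
    obtain ⟨M, hM⟩ := g.bdd
    exact ⟨N + M, fun _ hn => mulCoeff_of_lt hN hM hn⟩)

noncomputable instance : One (PsDO d) := ⟨single 0 1⟩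

theorem coeff_mul (f g : PsDO d) (n : ℤ) : (f * g).coeff n =
    ∑ᶠ p : ℤ × ℕ, Ring.choose p.1 p.2 • (f.coeff p.1 * d^[p.2] (g.coeff (n - p.1 + p.2))) := rfl

theorem coeff_mul_of_lt {f g : PsDO d} {N M : ℤ} (hN : ∀ i, N < i → f.coeff i = 0)
    (hM : ∀ i, M < i → g.coeff i = 0) {n : ℤ} (hn : N + M < n) : (f * g).coeff n = 0 :=
  mulCoeff_of_lt hN hM hn

protected theorem left_distrib (f g h : PsDO d) : f * (g + h) = f * g + f * h := by
  ext n
  rw [coeff_add, coeff_mul, coeff_mul, coeff_mul,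
    ← finsum_add_distrib (mul_support f g n) (mul_support f h n)]
  refine finsum_congr fun p => ?_
  rw [coeff_add, RingDer.iter_add, mul_add, smul_add]

protected theorem right_distrib (f g h : PsDO d) : (f + g) * h = f * h + g * h := by
  ext n
  rw [coeff_add, coeff_mul, coeff_mul, coeff_mul,
    ← finsum_add_distrib (mul_support f h n) (mul_support g h n)]
  refine finsum_congr fun p => ?_
  rw [coeff_add, add_mul, smul_add]

theorem coeff_single_mul (i : ℤ) (a : A) (g : PsDO d) (n : ℤ) : (single i a * g).coeff n =
    ∑ᶠ k : ℕ, Ring.choose i k • (a * d^[k] (g.coeff (n - i + k))) := by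
  rw [coeff_mul, finsum_eq_comp _ (fun k : ℕ => ((i, k) : ℤ × ℕ)) fun _ _ h => (Prod.mk.inj h).2]
  · simp [coeff_single]
  · rintro ⟨j, k⟩ h
    have : j ≠ i := by rintro rfl; exact h ⟨k, rfl⟩
    simp [coeff_single, this]

theorem coeff_mul_single (f : PsDO d) (l : ℤ) (c : A) (n : ℤ) : (f * single l c).coeff n =
    ∑ᶠ k : ℕ, Ring.choose (n - l + k) k • (f.coeff (n - l + k) * d^[k] c) := by
  rw [coeff_mul, finsum_eq_comp _ (fun k : ℕ => ((n - l + k, k) : ℤ × ℕ))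
    fun _ _ h => (Prod.mk.inj h).2]
  · refine finsum_congr fun k => ?_
    have : n - (n - l + k) + k = l := by ring
    simp [coeff_single, this]
  · rintro ⟨j, k⟩ h
    have : ¬ n - j + k = l := by
      rintro rfl
      exact h ⟨k, Prod.ext (by dsimp only; ring) rfl⟩
    simp [coeff_single, this]

theorem coeff_single_mul_single (i j : ℤ) (a b : A) (k : ℕ) :
    (single i a * single j b : PsDO d).coeff (i + j - k) = Ring.choose i k • (a * d^[k] b) := by
  rw [coeff_single_mul, finsum_eq_single _ k]
  · have : i + j - k - i + k = j := by ring
    simp [coeff_single, this]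
  · intro m hm
    have : ¬ (i + j - k - i + m = j) := by omega
    simp [coeff_single, this]

theorem coeff_single_mul_single_of_lt (i j : ℤ) (a b : A) (n : ℤ) (h : i + j < n) :
    (single i a * single j b : PsDO d).coeff n = 0 :=
  coeff_mul_of_lt (N := i) (M := j) (fun m hm => by simp [coeff_single, hm.ne'])
    (fun m hm => by simp [coeff_single, hm.ne']) h

theorem choose_identity (i j : ℤ) (r m : ℕ) :
    ∑ p ∈ Finset.HasAntidiagonal.antidiagonal m,
      Ring.choose i (r + p.1) * Ring.choose j p.2 * ((r + p.1).choose r : ℤ) =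
    Ring.choose i r * Ring.choose (i + j - r) m := by
  have h : i + j - r = (i - r) + j := by ring
  rw [h, Ring.add_choose_eq m (Commute.all _ _), Finset.mul_sum]
  refine Finset.sum_congr rfl fun p _ => ?_
  have := Ring.choose_smul_choose i (Nat.le_add_right r p.1)
  rw [Nat.add_sub_cancel_left, nsmul_eq_mul] at this
  linear_combination (Ring.choose j p.2) * this

theorem assoc_single (i j l : ℤ) (a b c : A) :
    (single i a * single j b * single l c : PsDO d) =
      single i a * (single j b * single l c) := by
  ext n
  by_cases hn : i + j + l < n
  · rw [coeff_mul_of_lt (N := i + j) (M := l) (coeff_single_mul_single_of_lt i j a b)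
      (fun m hm => by simp [coeff_single, hm.ne']) hn,
      coeff_mul_of_lt (N := i) (M := j + l) (fun m hm => by simp [coeff_single, hm.ne'])
      (coeff_single_mul_single_of_lt j l b c) (by omega)]
  obtain ⟨N, hN⟩ : ∃ N : ℕ, i + j + l - n = N := ⟨(i + j + l - n).toNat, by omega⟩
  obtain rfl : n = i + j + l - N := by omega
  have hL : (single i a * single j b * single l c : PsDO d).coeff (i + j + l - N) =
      ∑ p ∈ Finset.HasAntidiagonal.antidiagonal N,
        (Ring.choose i p.1 * Ring.choose (i + j - p.1) p.2) • (a * (d^[p.1] b * d^[p.2] c)) := by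
    rw [coeff_mul_single, finsum_eq_sum_of_support_subset (s := Finset.range (N + 1)),
      Finset.Nat.sum_antidiagonal_eq_sum_range_succ_mk, ← Finset.sum_range_reflect]
    · refine Finset.sum_congr rfl fun m hm => ?_
      have hm' : m ≤ N := by simpa [Nat.lt_succ_iff] using hm
      have e1 : N + 1 - 1 - m = N - m := by omega
      have e2 : i + j + l - N - l + ((N - m : ℕ) : ℤ) = i + j - m := by omega
      rw [e1, e2, coeff_single_mul_single, smul_mul_assoc, smul_smul, mul_assoc, mul_comm]
    · intro m hm
      simp only [Finset.coe_range, Set.mem_Iio]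
      by_contra h
      exact hm (by simp [coeff_single_mul_single_of_lt i j a b (i + j + l - N - l + m) (by omega)])
  have hR : (single i a * (single j b * single l c) : PsDO d).coeff (i + j + l - N) =
      ∑ p ∈ Finset.HasAntidiagonal.antidiagonal N,
        (Ring.choose i p.1 * Ring.choose j p.2) • (a * d^[p.1] (b * d^[p.2] c)) := by
    rw [coeff_single_mul, finsum_eq_sum_of_support_subset (s := Finset.range (N + 1)),
      Finset.Nat.sum_antidiagonal_eq_sum_range_succ_mk]
    · refine Finset.sum_congr rfl fun m hm => ?_
      have hm' : m ≤ N := by simpa [Nat.lt_succ_iff] using hm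
      have e2 : i + j + l - N - i + m = j + l - ((N - m : ℕ) : ℤ) := by omega
      rw [e2, coeff_single_mul_single, RingDer.iter_zsmul, mul_smul_comm, smul_smul]
    · intro m hm
      simp only [Finset.coe_range, Set.mem_Iio]
      by_contra h
      refine hm ?_
      dsimp only
      rw [coeff_single_mul_single_of_lt j l b c (i + j + l - N - i + m) (by omega)]
      simp
  rw [hL, hR]
  have h1 : ∀ p ∈ Finset.HasAntidiagonal.antidiagonal N,
      (Ring.choose i p.1 * Ring.choose j p.2) • (a * d^[p.1] (b * d^[p.2] c)) =
      ∑ s ∈ Finset.HasAntidiagonal.antidiagonal p.1,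
        (Ring.choose i (s.1 + s.2) * Ring.choose j p.2 * ((s.1 + s.2).choose s.1 : ℤ)) •
          (a * (d^[s.1] b * d^[s.2 + p.2] c)) := by
    intro p _
    rw [RingDer.iter_leibniz, Finset.mul_sum, Finset.smul_sum]
    refine Finset.sum_congr rfl fun s hs => ?_
    rw [Finset.HasAntidiagonal.mem_antidiagonal] at hs
    rw [hs, mul_smul_comm, ← Function.iterate_add_apply, ← natCast_zsmul, smul_smul]
  rw [Finset.sum_congr rfl h1, Finset.sum_sigma']
  have h2 : ∀ p ∈ Finset.HasAntidiagonal.antidiagonal N,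
      (Ring.choose i p.1 * Ring.choose (i + j - p.1) p.2) • (a * (d^[p.1] b * d^[p.2] c)) =
      ∑ s ∈ Finset.HasAntidiagonal.antidiagonal p.2,
        (Ring.choose i (p.1 + s.1) * Ring.choose j s.2 * ((p.1 + s.1).choose p.1 : ℤ)) •
          (a * (d^[p.1] b * d^[s.1 + s.2] c)) := by
    intro p _
    rw [← choose_identity, Finset.sum_smul]
    refine Finset.sum_congr rfl fun s hs => ?_
    rw [Finset.HasAntidiagonal.mem_antidiagonal] at hs
    rw [hs]
  rw [Finset.sum_congr rfl h2, Finset.sum_sigma']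
  refine Finset.sum_nbij' (fun x => ⟨(x.1.1 + x.2.1, x.2.2), (x.1.1, x.2.1)⟩)
    (fun x => ⟨(x.2.1, x.2.2 + x.1.2), (x.2.2, x.1.2)⟩) ?_ ?_ ?_ ?_ ?_
  · rintro ⟨⟨p, q⟩, ⟨s, t⟩⟩
    simp only [Finset.mem_sigma, Finset.HasAntidiagonal.mem_antidiagonal]
    rintro ⟨rfl, rfl⟩
    simp [add_assoc]
  · rintro ⟨⟨p, q⟩, ⟨s, t⟩⟩
    simp only [Finset.mem_sigma, Finset.HasAntidiagonal.mem_antidiagonal]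
    rintro ⟨rfl, rfl⟩
    simp [add_assoc]
  · rintro ⟨⟨p, q⟩, ⟨s, t⟩⟩
    simp only [Finset.mem_sigma, Finset.HasAntidiagonal.mem_antidiagonal]
    rintro ⟨h, rfl⟩
    rfl
  · rintro ⟨⟨p, q⟩, ⟨s, t⟩⟩
    simp only [Finset.mem_sigma, Finset.HasAntidiagonal.mem_antidiagonal]
    rintro ⟨h, rfl⟩
    rfl
  · rintro ⟨⟨p, q⟩, ⟨s, t⟩⟩ _
    rfl

theorem eq_zero_of_single (F : PsDO d → A) (hadd : ∀ x y, F (x + y) = F x + F y)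
    (hs : ∀ i a, F (single i a) = 0)
    (hK : ∃ K : ℤ, ∀ f : PsDO d, (∀ i, K < i → f.coeff i = 0) → F f = 0) (f : PsDO d) :
    F f = 0 := by
  obtain ⟨K, hK⟩ := hK
  obtain ⟨N, hN⟩ := f.bdd
  let G : PsDO d →+ A := AddMonoidHom.mk' F hadd
  have hsum : ∀ (s : Finset ℤ) (n : ℤ),
      (∑ i ∈ s, single i (f.coeff i) : PsDO d).coeff n = if n ∈ s then f.coeff n else 0 := by
    intro s n
    induction s using Finset.induction_on with
    | empty => simp
    | insert i s hi ih =>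
      rw [Finset.sum_insert hi, coeff_add, ih, coeff_single]
      by_cases h : n = i
      · subst h; simp [hi]
      · simp [h]
  have hsplit : f = (∑ i ∈ Finset.Ioc K N, single i (f.coeff i)) +
      (f - ∑ i ∈ Finset.Ioc K N, single i (f.coeff i)) := by abel
  have h1 : G (∑ i ∈ Finset.Ioc K N, single i (f.coeff i)) = 0 := by
    rw [map_sum]
    exact Finset.sum_eq_zero fun i _ => hs i _
  have h2 : F (f - ∑ i ∈ Finset.Ioc K N, single i (f.coeff i)) = 0 := by
    refine hK _ fun i hi => ?_
    rw [coeff_sub, hsum]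
    by_cases h : i ≤ N
    · simp [hi, h]
    · simp [h, hN i (not_le.mp h)]
  rw [hsplit, hadd, h2, add_zero]
  exact h1

protected theorem mul_assoc (f g h : PsDO d) : f * g * h = f * (g * h) := by
  have key : ∀ (n : ℤ) (f g h : PsDO d), (f * g * h - f * (g * h)).coeff n = 0 := by
    intro n f g h
    have hord : ∀ (f g h : PsDO d) (N M K : ℤ), (∀ i, N < i → f.coeff i = 0) →
        (∀ i, M < i → g.coeff i = 0) → (∀ i, K < i → h.coeff i = 0) → N + M + K < n →
        (f * g * h - f * (g * h)).coeff n = 0 := by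
      intro f g h N M K hN hM hK hn
      rw [coeff_sub, coeff_mul_of_lt (N := N + M) (M := K) (fun _ => coeff_mul_of_lt hN hM) hK hn,
        coeff_mul_of_lt (N := N) (M := M + K) hN (fun _ => coeff_mul_of_lt hM hK) (by omega),
        sub_zero]
    have hsingle : ∀ (i : ℤ) (a : A) (j : ℤ), i < j → (single i a : PsDO d).coeff j = 0 :=
      fun i a j hj => by simp [coeff_single, hj.ne']
    refine eq_zero_of_single (fun f => (f * g * h - f * (g * h)).coeff n) ?_ ?_ ?_ f
    · intro x y
      rw [← coeff_add, PsDO.right_distrib, PsDO.right_distrib, PsDO.right_distrib]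
      congr 1; abel
    rotate_left
    · obtain ⟨M, hM⟩ := g.bdd
      obtain ⟨K, hK⟩ := h.bdd
      exact ⟨n - M - K - 1, fun f hf => hord f g h _ M K hf hM hK (by omega)⟩
    intro i a
    refine eq_zero_of_single (fun g => (single i a * g * h - single i a * (g * h)).coeff n)
      ?_ ?_ ?_ g
    · intro x y
      rw [← coeff_add, PsDO.left_distrib, PsDO.right_distrib, PsDO.right_distrib,
        PsDO.left_distrib]
      congr 1; abel
    rotate_left
    · obtain ⟨K, hK⟩ := h.bdd
      exact ⟨n - i - K - 1, fun g hg => hord _ g h i _ K (hsingle i a) hg hK (by omega)⟩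
    intro j b
    refine eq_zero_of_single
      (fun h => (single i a * single j b * h - single i a * (single j b * h)).coeff n) ?_ ?_ ?_ h
    · intro x y
      rw [← coeff_add, PsDO.left_distrib, PsDO.left_distrib, PsDO.left_distrib]
      congr 1; abel
    · intro l c
      rw [assoc_single, sub_self, coeff_zero]
    · exact ⟨n - i - j - 1, fun h hh => hord _ _ h i j _ (hsingle i a) (hsingle j b) hh (by omega)⟩
  ext n
  have := key n f g h
  rw [coeff_sub] at this
  exact sub_eq_zero.mp this

theorem one_def : (1 : PsDO d) = single 0 1 := rfl

protected theorem one_mul (f : PsDO d) : 1 * f = f := by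
  ext n
  rw [one_def, coeff_single_mul, finsum_eq_single _ 0]
  · simp
  · intro k hk
    rw [Ring.choose_zero_pos ℤ (Nat.pos_of_ne_zero hk), zero_smul]

protected theorem mul_one (f : PsDO d) : f * 1 = f := by
  ext n
  rw [one_def, coeff_mul_single, finsum_eq_single _ 0]
  · simp
  · intro k hk
    obtain ⟨k, rfl⟩ := Nat.exists_eq_succ_of_ne_zero hk
    rw [Function.iterate_succ_apply, d.map_one, d.iter_zero, mul_zero, smul_zero]

noncomputable instance : Ring (PsDO d) :=
  { (inferInstance : AddCommGroup (PsDO d)) with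
    mul := (· * ·)
    one := 1
    left_distrib := PsDO.left_distrib
    right_distrib := PsDO.right_distrib
    mul_assoc := PsDO.mul_assoc
    one_mul := PsDO.one_mul
    mul_one := PsDO.mul_one
    zero_mul := fun f => by
      have h := PsDO.right_distrib 0 0 f
      rw [add_zero] at h
      exact left_eq_add.mp h
    mul_zero := fun f => by
      have h := PsDO.left_distrib f 0 0
      rw [add_zero] at h
      exact left_eq_add.mp h }

/-- A derivation `e` of `A` that commutes with `d` acts on `A((∂⁻¹))` coefficientwise. -/
noncomputable def extendDer (e : RingDer A) (h : ∀ a, e (d a) = d (e a)) : RingDer (PsDO d) where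
  toFun f := ofCoeff (fun i => e (f.coeff i)) (by
    obtain ⟨N, hN⟩ := f.bdd
    exact ⟨N, fun i hi => by simp only [hN i hi, map_zero]⟩)
  map_zero' := PsDO.ext fun i => map_zero e
  map_add' f g := PsDO.ext fun i => map_add e _ _
  leibniz' f g := PsDO.ext fun n => by
    have hc : ∀ k a, e (d^[k] a) = d^[k] (e a) := fun k a =>
      Function.Commute.iterate_right (f := e) (g := d) h k a
    rw [coeff_add, coeff_mul, coeff_mul, ← finsum_add_distrib (mul_support _ _ n)
      (mul_support _ _ n)]
    simp only [coeff_ofCoeff]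
    rw [coeff_mul]
    change e.toAddMonoidHom _ = _
    rw [AddMonoidHom.map_finsum _ (mul_support f g n)]
    refine finsum_congr fun p => ?_
    change e _ = _
    rw [map_zsmul, e.leibniz, smul_add, hc]

theorem coeff_extendDer (e : RingDer A) (h : ∀ a, e (d a) = d (e a)) (f : PsDO d) (i : ℤ) :
    (extendDer e h f).coeff i = e (f.coeff i) := rfl

end PsDO

/-- A ring with a family of pairwise commuting derivations. -/
structure DiffRing (ι : Type v) where
  /-- the underlying ring -/
  carrier : Type u
  [ring : Ring carrier]
  /-- the derivations -/
  der : ι → RingDer carrier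
  comm : ∀ i j a, der i (der j a) = der j (der i a)

attribute [instance] DiffRing.ring

namespace DiffRing

/-- `R((∂ᵢ⁻¹))`, with all the derivations of `R` extended coefficientwise. -/
noncomputable def psdo {ι : Type v} (R : DiffRing.{u} ι) (i : ι) : DiffRing.{u} ι where
  carrier := PsDO (R.der i)
  der j := PsDO.extendDer (R.der j) (R.comm j i)
  comm j l a := PsDO.ext fun m => R.comm j l (a.coeff m)

/-- The iterated ring `R((∂₁⁻¹))…((∂ⱼ⁻¹))`; the index `i : Fin n` stands for the variable number
`i + 1`. -/
noncomputable def iter {n : ℕ} (R : DiffRing.{u} (Fin n)) : (j : ℕ) → j ≤ n → DiffRing.{u} (Fin n)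
  | 0, _ => R
  | j + 1, h => (iter R j (Nat.le_of_succ_le h)).psdo ⟨j, h⟩

/-- The coefficient of `∂₁ ^ α₁ ⋯ ∂ⱼ ^ αⱼ` of an element of `R((∂₁⁻¹))…((∂ⱼ⁻¹))`. -/
noncomputable def coeff {n : ℕ} (R : DiffRing.{u} (Fin n)) :
    (j : ℕ) → (h : j ≤ n) → (R.iter j h).carrier → (Fin j → ℤ) → R.carrier
  | 0, _, X, _ => X
  | j + 1, h, X, α => coeff R j (Nat.le_of_succ_le h)
      (PsDO.coeff (d := (R.iter j (Nat.le_of_succ_le h)).der ⟨j, h⟩) X (α (Fin.last j)))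
      (fun i => α i.castSucc)

/-- The operator `a ∂₁ ^ α₁ ⋯ ∂ⱼ ^ αⱼ` as an element of `R((∂₁⁻¹))…((∂ⱼ⁻¹))`. -/
noncomputable def monomial {n : ℕ} (R : DiffRing.{u} (Fin n)) :
    (j : ℕ) → (h : j ≤ n) → (Fin j → ℤ) → R.carrier → (R.iter j h).carrier
  | 0, _, _, a => a
  | j + 1, h, α, a => PsDO.single (d := (R.iter j (Nat.le_of_succ_le h)).der ⟨j, h⟩)
      (α (Fin.last j)) (monomial R j (Nat.le_of_succ_le h) (fun i => α i.castSucc) a)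

/-- The ring `k[[x₁, …, xₙ]]` with the derivations `∂/∂xᵢ`. -/
noncomputable def powerSeries (k : Type u) [Field k] (n : ℕ) : DiffRing.{u} (Fin n) where
  carrier := MvPowerSeries (Fin n) k
  der i :=
    { (MvPowerSeries.pderiv k i).toLinearMap.toAddMonoidHom with
      leibniz' := fun a b => by
        change MvPowerSeries.pderiv k i (a * b) =
          MvPowerSeries.pderiv k i a * b + a * MvPowerSeries.pderiv k i b
        rw [Derivation.leibniz, smul_eq_mul, smul_eq_mul]
        ring }
  comm i j a := by
    change MvPowerSeries.pderiv k i (MvPowerSeries.pderiv k j a) =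
      MvPowerSeries.pderiv k j (MvPowerSeries.pderiv k i a)
    ext m
    by_cases h : i = j
    · rw [h]
    · have h' : j ≠ i := fun e => h e.symm
      simp [MvPowerSeries.coeff_pderiv, h, h', add_right_comm, mul_right_comm]

end DiffRing

namespace PseudoDiff

/-- The ring `E = k[[x₁, …, xₙ]]((∂₁⁻¹))…((∂ₙ⁻¹))`. -/
def E (k : Type u) [Field k] (n : ℕ) : Type u :=
  ((DiffRing.powerSeries k n).iter n le_rfl).carrier

noncomputable instance (k : Type u) [Field k] (n : ℕ) : Ring (E k n) :=
  ((DiffRing.powerSeries k n).iter n le_rfl).ring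

variable {k : Type u} [Field k] {n : ℕ}

/-- The coefficient in `k[[x₁, …, xₙ]]` of `∂₁ ^ α₁ ⋯ ∂ₙ ^ αₙ`. -/
noncomputable def coeff (X : E k n) (α : Fin n → ℤ) : MvPowerSeries (Fin n) k :=
  (DiffRing.powerSeries k n).coeff n le_rfl X α

/-- The operator `∂ᵢ` in `E`. -/
noncomputable def del (i : Fin n) : E k n :=
  (DiffRing.powerSeries k n).monomial n le_rfl (Pi.single i 1) (1 : MvPowerSeries (Fin n) k)

/-- For `E = E'((∂ₙ⁻¹))` with `n ≥ 1` variables (here `n + 1` of them), the coefficient in `E'` of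
the power `m` of the last derivative. -/
noncomputable def lastCoeff (X : E k (n + 1)) (m : ℤ) :
    ((DiffRing.powerSeries k (n + 1)).iter n (Nat.le_succ n)).carrier :=
  PsDO.coeff (d := ((DiffRing.powerSeries k (n + 1)).iter n (Nat.le_succ n)).der (Fin.last n)) X m

/-- `E₋`: the operators that contain only negative powers of the last derivative. -/
def EMinus (k : Type u) [Field k] (n : ℕ) : Set (E k (n + 1)) :=
  {X | ∀ m : ℤ, 0 ≤ m → lastCoeff X m = 0}

/-- The field `k((z₁))…((zₙ))` of iterated Laurent series, bundled with its field structure. -/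
noncomputable def iterLaurentAux (k : Type u) [Field k] : ℕ → (A : Type u) ×' Field A
  | 0 => ⟨k, inferInstance⟩
  | n + 1 =>
    letI := (iterLaurentAux k n).2
    ⟨LaurentSeries (iterLaurentAux k n).1, inferInstance⟩

/-- The field `k((z₁))…((zₙ))` of iterated Laurent series. -/
def IterLaurent (k : Type u) [Field k] (n : ℕ) : Type u := (iterLaurentAux k n).1

noncomputable instance (k : Type u) [Field k] (n : ℕ) : Field (IterLaurent k n) :=
  (iterLaurentAux k n).2

/-- The coefficient of `z₁ ^ α₁ ⋯ zₙ ^ αₙ` of an iterated Laurent series. -/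
noncomputable def laurentCoeff : (n : ℕ) → IterLaurent k n → (Fin n → ℤ) → k
  | 0, c, _ => c
  | n + 1, c, α =>
    letI := (iterLaurentAux k n).2
    laurentCoeff n (HahnSeries.coeff (Γ := ℤ) (R := IterLaurent k n) c (α (Fin.last n)))
      (fun i => α i.castSucc)

/-- The ordered product `U₁ ^ α₁ ⋯ Uₙ ^ αₙ`. -/
noncomputable def zpowProd (U : Fin n → (E k n)ˣ) (α : Fin n → ℤ) : (E k n)ˣ :=
  (List.ofFn fun i => U i ^ α i).prod

/-- `X = ∑ c_α U₁ ^ (-α₁) ⋯ Uₙ ^ (-αₙ)`, where `c = ∑ c_α z ^ α` is an iterated Laurent series: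
the sum converges coefficientwise, i.e. every coefficient of `X` is the sum of the corresponding
coefficients of the terms, only finitely many of which are nonzero. -/
def IsLaurentSum (U : Fin n → (E k n)ˣ) (c : IterLaurent k n) (X : E k n) : Prop :=
  ∀ β : Fin n → ℤ,
    {α : Fin n → ℤ | laurentCoeff n c α • coeff (zpowProd U (-α) : E k n) β ≠ 0}.Finite ∧
    coeff X β = ∑ᶠ α : Fin n → ℤ, laurentCoeff n c α • coeff (zpowProd U (-α) : E k n) β

/-- The set `k((U₁⁻¹))…((Uₙ⁻¹))` of all operators that are sums of iterated Laurent series in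
`U₁⁻¹, …, Uₙ⁻¹` with coefficients in `k`. -/
def laurentIn (U : Fin n → (E k n)ˣ) : Set (E k n) :=
  {X | ∃ c : IterLaurent k n, IsLaurentSum U c X}

end PseudoDiff

/-! Write `L i = ∂ i + T i` with `T i` of order at most `-1`. That the `L i` commute says that the
connection `∂ i + T i` is flat, so a parallel section `S` with `∂ᵢ S + T i * S = 0` is to be
expected, and such an `S` satisfies `L i * S = S * ∂ i`. In characteristic zero the Poincaré lemma
holds for `k[[x₁, …, xₙ]]`, by an explicit homotopy `J` acting coefficientwise on operators, and `S`
is the solution of `S = 1 - J (T * S)`, which exists because `J (T * ·)` lowers the order. Flatness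
makes each residual `∂ᵢ S + T i * S` of order one less than any bound common to all of them, so they
vanish; and `S` is invertible because it is `1` up to negative order.

Conjugation by `S` thus reduces the theorem to `L i = ∂ i`. An operator commutes with every `∂ i`
iff all derivatives of its coefficients vanish, that is, iff its coefficients are scalars, and these
operators form `k((∂₁⁻¹))⋯((∂ₙ⁻¹))`. Convergence survives the conjugation because multiplication by
a fixed operator commutes with coefficientwise sums whose orders are bounded at every stage. -/

namespace PsDO

section Order

variable {A : Type u} [Ring A] {d : RingDer A}

/-- The operators of order at most `N`, the filtration with respect to which `A((∂⁻¹))` is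
complete. -/
def ordLE (d : RingDer A) (N : ℤ) : AddSubgroup (PsDO d) where
  carrier := {f | ∀ m, N < m → f.coeff m = 0}
  zero_mem' _ _ := rfl
  add_mem' hf hg m hm := by rw [coeff_add, hf m hm, hg m hm, add_zero]
  neg_mem' hf m hm := by rw [coeff_neg, hf m hm, neg_zero]

theorem exists_mem_ordLE (f : PsDO d) : ∃ N, f ∈ ordLE d N := f.bdd

theorem ordLE_mono : Monotone (ordLE d) := fun _ _ h _ hf m hm => hf m (h.trans_lt hm)

theorem single_mem_ordLE (i : ℤ) (a : A) : single i a ∈ ordLE d i :=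
  fun _ hm => if_neg hm.ne'

theorem one_mem_ordLE : (1 : PsDO d) ∈ ordLE d 0 := single_mem_ordLE 0 1

theorem mul_mem_ordLE {f g : PsDO d} {N M : ℤ} (hf : f ∈ ordLE d N) (hg : g ∈ ordLE d M) :
    f * g ∈ ordLE d (N + M) :=
  fun _ => coeff_mul_of_lt hf hg

theorem extendDer_mem_ordLE {e : RingDer A} (h : ∀ a, e (d a) = d (e a)) {f : PsDO d} {N : ℤ}
    (hf : f ∈ ordLE d N) : extendDer e h f ∈ ordLE d N :=
  fun m hm => by rw [coeff_extendDer, hf m hm, map_zero]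

theorem eq_zero_of_forall_mem_ordLE {f : PsDO d} {N : ℤ} (h : ∀ r : ℕ, f ∈ ordLE d (N - r)) :
    f = 0 :=
  ext fun m => h (N - m + 1).toNat m (by omega)

theorem coeff_sum {κ : Type*} (s : Finset κ) (F : κ → PsDO d) (m : ℤ) :
    (∑ q ∈ s, F q).coeff m = ∑ q ∈ s, (F q).coeff m :=
  map_sum (AddMonoidHom.mk' (fun f : PsDO d => f.coeff m) fun f g => coeff_add f g m) F s

theorem exists_sub_sum_range_mem_ordLE {F : ℕ → PsDO d} {N : ℤ}
    (hF : ∀ q : ℕ, F q ∈ ordLE d (N - q)) :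
    ∃ X : PsDO d, ∀ r : ℕ, X - ∑ q ∈ Finset.range r, F q ∈ ordLE d (N - r) := by
  refine ⟨ofCoeff (fun m => ∑ q ∈ Finset.range (N - m + 1).toNat, (F q).coeff m)
    ⟨N, fun m hm => ?_⟩, fun r m hm => ?_⟩
  · rw [Int.toNat_of_nonpos (by omega), Finset.sum_range_zero]
  · rw [coeff_sub, coeff_ofCoeff, coeff_sum, sub_eq_zero]
    refine Finset.sum_subset (Finset.range_mono (by omega)) fun q _ hq => ?_
    rw [Finset.mem_range] at hq
    exact hF q m (by omega)

/-- The solution is the Neumann series `∑ Φ ^ q Y`. -/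
theorem exists_eq_add_of_lowers_order {Φ : PsDO d →+ PsDO d}
    (hΦ : ∀ N, ∀ X ∈ ordLE d N, Φ X ∈ ordLE d (N - 1)) {Y : PsDO d} {N : ℤ} (hY : Y ∈ ordLE d N) :
    ∃ X ∈ ordLE d N, X = Y + Φ X := by
  have hpow : ∀ q : ℕ, Φ^[q] Y ∈ ordLE d (N - q) := fun q => by
    induction q with
    | zero => simpa using hY
    | succ q ih =>
      rw [Function.iterate_succ_apply', Nat.cast_succ, ← sub_sub]
      exact hΦ _ _ ih
  obtain ⟨X, hX⟩ := exists_sub_sum_range_mem_ordLE hpow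
  refine ⟨X, by simpa using hX 0,
    sub_eq_zero.mp (eq_zero_of_forall_mem_ordLE (N := N) fun r => ?_)⟩
  have hsplit : X - (Y + Φ X) = (X - ∑ q ∈ Finset.range (r + 1), Φ^[q] Y) -
      Φ (X - ∑ q ∈ Finset.range r, Φ^[q] Y) := by
    simp only [Finset.sum_range_succ', Function.iterate_succ_apply', Function.iterate_zero, id_eq,
      map_sub, map_sum]
    abel
  rw [hsplit]
  exact sub_mem (ordLE_mono (by omega) (hX (r + 1))) (ordLE_mono (by omega) (hΦ _ _ (hX r)))

theorem exists_one_add_mul_one_add_eq_one {T : PsDO d} (hT : T ∈ ordLE d (-1)) :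
    ∃ T' ∈ ordLE d (-1), (1 + T) * (1 + T') = 1 := by
  obtain ⟨T', hT', h⟩ := exists_eq_add_of_lowers_order (Φ := AddMonoidHom.mulLeft (-T))
    (fun N X hX => ordLE_mono (by omega) (mul_mem_ordLE (neg_mem hT) hX)) (neg_mem hT)
  have h : T' = -T + -T * T' := h
  refine ⟨T', hT', ?_⟩
  calc (1 + T) * (1 + T') = 1 + (T' - (-T + -T * T')) := by noncomm_ring
    _ = 1 := by rw [sub_eq_zero.mpr h, add_zero]

theorem isUnit_one_add {T : PsDO d} (hT : T ∈ ordLE d (-1)) : IsUnit (1 + T) := by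
  obtain ⟨T', hT', h⟩ := exists_one_add_mul_one_add_eq_one hT
  obtain ⟨T'', -, h'⟩ := exists_one_add_mul_one_add_eq_one hT'
  exact ⟨⟨1 + T, 1 + T', h, by rwa [← left_inv_eq_right_inv h h'] at h'⟩, rfl⟩

end Order

section MapCoeff

variable {A : Type u} [Ring A] {d : RingDer A} {ι : Type v} [Finite ι]

theorem exists_forall_mem_ordLE (b : ι → PsDO d) : ∃ N, ∀ i, b i ∈ ordLE d N := by
  choose N hN using fun i => (b i).exists_mem_ordLE
  obtain ⟨M, hM⟩ := (Set.finite_range N).bddAbove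
  exact ⟨M, fun i => ordLE_mono (hM ⟨i, rfl⟩) (hN i)⟩

/-- The coefficientwise action of an additive map on finite families of operators. -/
noncomputable def mapCoeff (J : (ι → A) →+ A) : (ι → PsDO d) →+ PsDO d where
  toFun b := ofCoeff (fun m => J fun i => (b i).coeff m) (by
    obtain ⟨N, hN⟩ := exists_forall_mem_ordLE b
    exact ⟨N, fun m hm => (congrArg J (funext fun i => hN i m hm)).trans (map_zero J)⟩)
  map_zero' := ext fun _ => map_zero J
  map_add' _ _ := ext fun _ => map_add J _ _

theorem mapCoeff_mem_ordLE (J : (ι → A) →+ A) {b : ι → PsDO d} {N : ℤ}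
    (hb : ∀ i, b i ∈ ordLE d N) : mapCoeff J b ∈ ordLE d N :=
  fun m hm => (congrArg J (funext fun i => hb i m hm)).trans (map_zero J)

end MapCoeff

end PsDO

namespace DiffRing

variable {ι : Type v} {R : DiffRing.{u} ι}

/-- `J` integrates closed families: it solves the system `∂ᵢ y = bᵢ` whenever the compatibility
conditions `∂ᵢ bⱼ = ∂ⱼ bᵢ` hold. On other families it is merely required to be additive. -/
def IsAntiderivative (R : DiffRing.{u} ι) (J : (ι → R.carrier) →+ R.carrier) : Prop :=
  ∀ b : ι → R.carrier, (∀ i j, R.der i (b j) = R.der j (b i)) → ∀ i, R.der i (J b) = b i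

/-- The derivation `(R.psdo l).der i`, with the carrier of `R.psdo l` unfolded so that the
operations of `PsDO` apply. -/
noncomputable abbrev psdoDer (R : DiffRing.{u} ι) (l i : ι) : RingDer (PsDO (R.der l)) :=
  PsDO.extendDer (R.der i) (R.comm i l)

theorem psdoDer_comm (l i j : ι) (f : PsDO (R.der l)) :
    R.psdoDer l i (R.psdoDer l j f) = R.psdoDer l j (R.psdoDer l i f) :=
  (R.psdo l).comm i j f

variable {l : ι}

/-- The vanishing of the curvature of the connection `∂ᵢ + T i`, evaluated on `S`. -/
theorem psdoDer_covariant_comm {T : ι → PsDO (R.der l)}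
    (hflat : ∀ i j, R.psdoDer l i (T j) + T i * T j = R.psdoDer l j (T i) + T j * T i)
    (S : PsDO (R.der l)) (i j : ι) :
    R.psdoDer l i (R.psdoDer l j S + T j * S) + T i * (R.psdoDer l j S + T j * S) =
      R.psdoDer l j (R.psdoDer l i S + T i * S) + T j * (R.psdoDer l i S + T i * S) := by
  calc
    _ = R.psdoDer l i (R.psdoDer l j S) + (R.psdoDer l i (T j) + T i * T j) * S +
        (T j * R.psdoDer l i S + T i * R.psdoDer l j S) := by
      rw [map_add, RingDer.leibniz]; noncomm_ring
    _ = R.psdoDer l j (R.psdoDer l i S) + (R.psdoDer l j (T i) + T j * T i) * S +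
        (T j * R.psdoDer l i S + T i * R.psdoDer l j S) := by rw [psdoDer_comm, hflat]
    _ = _ := by rw [map_add, RingDer.leibniz]; noncomm_ring

variable [Finite ι] {J : (ι → R.carrier) →+ R.carrier}

theorem IsAntiderivative.psdoDer_mapCoeff_sub_mem_ordLE (hJ : R.IsAntiderivative J)
    {b : ι → PsDO (R.der l)} {N : ℤ}
    (hb : ∀ i j, R.psdoDer l i (b j) - R.psdoDer l j (b i) ∈ PsDO.ordLE (R.der l) N) (i : ι) :
    R.psdoDer l i (PsDO.mapCoeff J b) - b i ∈ PsDO.ordLE (R.der l) N :=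
  fun m hm => sub_eq_zero.mpr (hJ _ (fun i j => sub_eq_zero.mp (hb i j m hm)) i)

theorem IsAntiderivative.psdo (hJ : R.IsAntiderivative J) (l : ι) :
    (R.psdo l).IsAntiderivative (PsDO.mapCoeff (d := R.der l) J) := fun _ hb i =>
  PsDO.ext (d := R.der l) fun m => hJ _ (fun i j =>
    congrArg (fun X : PsDO (R.der l) => X.coeff m) (hb i j)) i

/-- The integrability conditions of `b i = -(T i * S)` only fail by the curvature terms, and these
are one order smaller than the residuals. -/
theorem IsAntiderivative.residual_mem_ordLE (hJ : R.IsAntiderivative J) {T : ι → PsDO (R.der l)}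
    (hT : ∀ i, T i ∈ PsDO.ordLE (R.der l) (-1))
    (hflat : ∀ i j, R.psdoDer l i (T j) + T i * T j = R.psdoDer l j (T i) + T j * T i)
    {S : PsDO (R.der l)} (hS : S = 1 + PsDO.mapCoeff J fun i => -(T i * S)) {N : ℤ}
    (hN : ∀ i, R.psdoDer l i S + T i * S ∈ PsDO.ordLE (R.der l) N) (i : ι) :
    R.psdoDer l i S + T i * S ∈ PsDO.ordLE (R.der l) (N - 1) := by
  have hcurv : ∀ i j, R.psdoDer l i (-(T j * S)) - R.psdoDer l j (-(T i * S)) =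
      T i * (R.psdoDer l j S + T j * S) - T j * (R.psdoDer l i S + T i * S) := fun i j => by
    have h := psdoDer_covariant_comm hflat S i j
    rw [map_add, map_add, psdoDer_comm l i j, ← sub_eq_zero] at h
    rw [map_neg, map_neg, ← sub_eq_zero, ← neg_eq_zero, ← h]
    abel
  have hder : R.psdoDer l i S + T i * S =
      R.psdoDer l i (PsDO.mapCoeff J fun i => -(T i * S)) - -(T i * S) := by
    conv_lhs => enter [1]; rw [hS]
    rw [map_add, RingDer.map_one, zero_add, sub_neg_eq_add]
  rw [hder]
  refine hJ.psdoDer_mapCoeff_sub_mem_ordLE (fun i j => ?_) i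
  rw [hcurv]
  exact sub_mem (PsDO.ordLE_mono (by omega) (PsDO.mul_mem_ordLE (hT i) (hN j)))
    (PsDO.ordLE_mono (by omega) (PsDO.mul_mem_ordLE (hT j) (hN i)))

theorem IsAntiderivative.exists_dressing (hJ : R.IsAntiderivative J) {T : ι → PsDO (R.der l)}
    (hT : ∀ i, T i ∈ PsDO.ordLE (R.der l) (-1))
    (hflat : ∀ i j, R.psdoDer l i (T j) + T i * T j = R.psdoDer l j (T i) + T j * T i) :
    ∃ S : (PsDO (R.der l))ˣ, ∀ i, R.psdoDer l i S = -(T i * S) := by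
  let Φ : PsDO (R.der l) →+ PsDO (R.der l) :=
    (PsDO.mapCoeff J).comp (AddMonoidHom.pi fun i => -AddMonoidHom.mulLeft (T i))
  have hΦ : ∀ N, ∀ X ∈ PsDO.ordLE (R.der l) N, Φ X ∈ PsDO.ordLE (R.der l) (N - 1) :=
    fun N X hX => PsDO.mapCoeff_mem_ordLE J fun i =>
      PsDO.ordLE_mono (by omega) (neg_mem (PsDO.mul_mem_ordLE (hT i) hX))
  obtain ⟨S, hS0, hS⟩ := PsDO.exists_eq_add_of_lowers_order hΦ PsDO.one_mem_ordLE
  obtain ⟨u, rfl⟩ : IsUnit S := hS ▸ PsDO.isUnit_one_add (hΦ 0 S hS0)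
  have hres : ∀ r : ℕ, ∀ i,
      R.psdoDer l i u + T i * u ∈ PsDO.ordLE (R.der l) (0 - r) := fun r => by
    induction r with
    | zero =>
      exact fun i => PsDO.ordLE_mono (by simp) (add_mem
        (PsDO.extendDer_mem_ordLE (R.comm i l) hS0)
        (PsDO.ordLE_mono (by omega) (PsDO.mul_mem_ordLE (hT i) hS0)))
    | succ r ih =>
      rw [Nat.cast_succ, ← sub_sub]
      exact hJ.residual_mem_ordLE hT hflat hS ih
  exact ⟨u, fun i => eq_neg_of_add_eq_zero_left
    (PsDO.eq_zero_of_forall_mem_ordLE fun r => hres r i)⟩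

theorem IsAntiderivative.exists_conjugation (hJ : R.IsAntiderivative J)
    {x L : ι → PsDO (R.der l)} (hx : ∀ i f, x i * f - f * x i = R.psdoDer l i f)
    (hxx : ∀ i j, x i * x j = x j * x i) (hL : ∀ i, L i - x i ∈ PsDO.ordLE (R.der l) (-1))
    (hLL : ∀ i j, L i * L j = L j * L i) :
    ∃ S : (PsDO (R.der l))ˣ, ∀ i, L i * S = S * x i := by
  obtain ⟨S, hS⟩ := hJ.exists_dressing hL fun i j => by
    rw [← hx, ← hx, ← sub_eq_zero]
    calc _ = (L i * L j - L j * L i) - (x i * x j - x j * x i) := by noncomm_ring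
      _ = 0 := by rw [hLL i j, hxx i j, sub_self, sub_self, sub_zero]
  refine ⟨S, fun i => ?_⟩
  have h := hS i
  rw [← hx, sub_mul, neg_sub] at h
  exact (sub_right_injective h).symm

end DiffRing

theorem map_coeff_laurentSeries_mul {K A : Type*} [Semiring K] [Semiring A] (ψ : K →+* A)
    (c e : LaurentSeries K) (n : ℤ) :
    ψ (HahnSeries.coeff (c * e) n) =
      ∑ᶠ i, ψ (HahnSeries.coeff c i) * ψ (HahnSeries.coeff e (n - i)) := by
  classical
  have hinj : Set.InjOn Prod.fst
      (Finset.antidiagonal c.isPWO_support e.isPWO_support n : Set (ℤ × ℤ)) := by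
    intro p hp q hq h
    rw [Finset.mem_coe, Finset.mem_antidiagonal] at hp hq
    exact Prod.ext h (by omega)
  rw [HahnSeries.coeff_mul, map_sum, finsum_eq_sum_of_support_subset
    (s := (Finset.antidiagonal c.isPWO_support e.isPWO_support n).image Prod.fst),
    Finset.sum_image hinj]
  · refine Finset.sum_congr rfl fun p hp => ?_
    rw [Finset.mem_antidiagonal] at hp
    rw [map_mul, ← hp.2.2, add_sub_cancel_left]
  · intro i hi
    have hc : HahnSeries.coeff c i ≠ 0 := fun h => hi (by simp only [h, map_zero, zero_mul])
    have he : HahnSeries.coeff e (n - i) ≠ 0 := fun h =>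
      hi (by simp only [h, map_zero, mul_zero])
    exact Finset.mem_coe.mpr (Finset.mem_image.mpr
      ⟨(i, n - i), Finset.mem_antidiagonal.mpr ⟨hc, he, add_sub_cancel i n⟩, rfl⟩)

namespace PsDO

variable {A : Type u} [Ring A] {d : RingDer A}

theorem coeff_single_zero_mul (a : A) (f : PsDO d) (m : ℤ) :
    (single 0 a * f).coeff m = a * f.coeff m := by
  rw [coeff_single_mul, finsum_eq_single _ 0]
  · simp
  · intro q hq
    rw [Ring.choose_zero_pos ℤ (Nat.pos_of_ne_zero hq), zero_smul]

theorem coeff_mul_of_der_eq_zero (f : PsDO d) {g : PsDO d} (hg : ∀ m, d (g.coeff m) = 0) (m : ℤ) :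
    (f * g).coeff m = ∑ᶠ i : ℤ, f.coeff i * g.coeff (m - i) := by
  rw [coeff_mul, finsum_eq_comp _ (fun i : ℤ => ((i, 0) : ℤ × ℕ)) fun _ _ h => (Prod.mk.inj h).1]
  · simp
  · rintro ⟨i, q⟩ h
    obtain ⟨q, rfl⟩ := Nat.exists_eq_succ_of_ne_zero (n := q) (by rintro rfl; exact h ⟨i, rfl⟩)
    rw [Function.iterate_succ_apply, hg, d.iter_zero, mul_zero, smul_zero]

theorem coeff_mul_single_of_der_eq_zero (f : PsDO d) (i : ℤ) {a : A} (ha : d a = 0) (m : ℤ) :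
    (f * single i a).coeff m = f.coeff (m - i) * a := by
  rw [coeff_mul_of_der_eq_zero, finsum_eq_single _ (m - i)]
  · rw [coeff_single, if_pos (sub_sub_cancel m i)]
  · intro j hj
    rw [coeff_single, if_neg (by omega), mul_zero]
  · intro j
    rw [coeff_single]
    split_ifs
    exacts [ha, map_zero d]

theorem single_mul_single_of_der_eq_zero (i j : ℤ) (a : A) {b : A} (hb : d b = 0) :
    (single i a * single j b : PsDO d) = single (i + j) (a * b) := by
  ext m
  rw [coeff_mul_single_of_der_eq_zero _ _ hb, coeff_single, coeff_single, ite_mul, zero_mul]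
  simp only [sub_eq_iff_eq_add]

theorem coeff_single_one_one_mul (f : PsDO d) (m : ℤ) :
    (single 1 1 * f).coeff m = f.coeff (m - 1) + d (f.coeff m) := by
  have hchoose : ∀ q : ℕ, 1 < q → Ring.choose (1 : ℤ) q = 0 := fun q hq => by
    simpa [Nat.choose_eq_zero_of_lt hq] using Ring.choose_natCast (R := ℤ) 1 q
  rw [coeff_single_mul, finsum_eq_sum_of_support_subset (s := Finset.range 2)]
  · simp [Finset.sum_range_succ]
  · intro q hq
    by_contra h
    have h1 : 1 < q := by simpa [Nat.lt_iff_add_one_le] using h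
    exact hq (by simp only [hchoose q h1, zero_smul])

theorem single_one_one_mul_sub (f : PsDO d) :
    single 1 1 * f - f * single 1 1 = extendDer d (fun _ => rfl) f := by
  ext m
  rw [coeff_sub, coeff_single_one_one_mul, coeff_mul_single_of_der_eq_zero _ _ d.map_one, mul_one,
    add_sub_cancel_left, coeff_extendDer]

theorem single_zero_mul_sub {e : RingDer A} (h : ∀ a, e (d a) = d (e a)) {x : A} (hx : d x = 0)
    (hxe : ∀ a, x * a - a * x = e a) (f : PsDO d) :
    single 0 x * f - f * single 0 x = extendDer e h f := by
  ext m
  rw [coeff_sub, coeff_single_zero_mul, coeff_mul_single_of_der_eq_zero _ _ hx, sub_zero, hxe,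
    coeff_extendDer]

theorem single_zero_mul_comm {x : A} (hx : d x = 0) (hcomm : ∀ a, x * a = a * x) (f : PsDO d) :
    single 0 x * f = f * single 0 x := by
  ext m
  rw [coeff_single_zero_mul, coeff_mul_single_of_der_eq_zero _ _ hx, sub_zero, hcomm]

section OfLaurent

variable {K : Type*} [Semiring K] (ψ : K →+* A) (hψ : ∀ c, d (ψ c) = 0)

/-- The embedding `∑ c_i z ^ i ↦ ∑ ψ c_i ∂ ^ (-i)` of Laurent series whose coefficients are mapped
to constants of `A`. -/
noncomputable def ofLaurent : LaurentSeries K →+* PsDO d where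
  toFun c := ofCoeff (fun m => ψ (HahnSeries.coeff c (-m))) ⟨-c.order, fun m hm => by
    rw [HahnSeries.coeff_eq_zero_of_lt_order (by omega), map_zero]⟩
  map_zero' := ext fun m => by simp
  map_add' c e := ext fun m => by simp
  map_one' := ext fun m => by
    rw [coeff_ofCoeff, one_def, coeff_single, HahnSeries.coeff_one]
    simp only [neg_eq_zero]
    split_ifs <;> simp
  map_mul' c e := ext fun m => by
    rw [coeff_mul_of_der_eq_zero _ fun m => hψ _]
    simp only [coeff_ofCoeff]
    rw [map_coeff_laurentSeries_mul, ← finsum_comp_equiv (Equiv.neg ℤ)]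
    simp only [Equiv.neg_apply, neg_sub_neg, neg_sub]

theorem coeff_ofLaurent (c : LaurentSeries K) (m : ℤ) :
    (ofLaurent (d := d) ψ hψ c).coeff m = ψ (HahnSeries.coeff c (-m)) := rfl

theorem mem_range_ofLaurent {f : PsDO d} (hf : ∀ m, f.coeff m ∈ Set.range ψ) :
    f ∈ Set.range (ofLaurent (d := d) ψ hψ) := by
  classical
  choose c hc using hf
  obtain ⟨N, hN⟩ := f.bdd
  have hbdd : BddBelow (Function.support fun i => if f.coeff (-i) = 0 then 0 else c (-i)) := by
    refine ⟨-N, fun i hi => ?_⟩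
    by_contra h
    exact hi (if_pos (hN _ (by omega)))
  refine ⟨HahnSeries.ofSuppBddBelow _ hbdd, ext fun m => ?_⟩
  rw [coeff_ofLaurent, HahnSeries.coeff_ofSuppBddBelow, neg_neg]
  split_ifs with h
  · rw [h, map_zero]
  · exact hc m

end OfLaurent

end PsDO

namespace DiffRing

section Constants

variable {ι : Type v} (R : DiffRing.{u} ι) (l : ι)

/-- The subring of elements annihilated by all the derivations. -/
def constants : Subring R.carrier where
  carrier := {c | ∀ i, R.der i c = 0}
  zero_mem' _ := map_zero _
  one_mem' i := (R.der i).map_one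
  add_mem' ha hb i := by rw [map_add, ha, hb, add_zero]
  neg_mem' ha i := by rw [map_neg, ha, neg_zero]
  mul_mem' ha hb i := by rw [RingDer.leibniz, ha, hb, zero_mul, mul_zero, add_zero]

variable {R} in
theorem single_mem_constants {c : R.carrier} (hc : c ∈ R.constants) (m : ℤ) :
    PsDO.single (d := R.der l) m c ∈ (R.psdo l).constants := fun i =>
  PsDO.ext (d := R.der l) fun q => by
    change R.der i (if q = m then c else 0) = 0
    split_ifs
    exacts [hc i, map_zero _]

variable {K : Type*} [Semiring K] (ψ : K →+* R.constants)

/-- The map `∑ c_i z ^ i ↦ ∑ ψ c_i ∂ₗ ^ (-i)`, as a map into the constants of `R((∂ₗ⁻¹))`. -/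
noncomputable def ofLaurent : LaurentSeries K →+* (R.psdo l).constants :=
  RingHom.codRestrict (S := PsDO (R.der l))
    (PsDO.ofLaurent (R.constants.subtype.comp ψ) fun c => (ψ c).2 l) (R.psdo l).constants
    fun _ i => PsDO.ext (d := R.der l) fun _ => (ψ _).2 i

theorem ofLaurent_surjective (hψ : Function.Surjective ψ) :
    Function.Surjective (R.ofLaurent l ψ) := by
  rintro ⟨f, hf⟩
  obtain ⟨c, rfl⟩ := PsDO.mem_range_ofLaurent (R.constants.subtype.comp ψ) (fun c => (ψ c).2 l)
    (f := f) fun m => by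
      obtain ⟨a, ha⟩ := hψ ⟨PsDO.coeff (d := R.der l) f m, fun i =>
        congrArg (fun X : PsDO (R.der l) => X.coeff m) (hf i)⟩
      exact ⟨a, congrArg Subtype.val ha⟩
  exact ⟨c, rfl⟩

end Constants

section Iter

variable {n : ℕ} (R : DiffRing.{u} (Fin n))

/-- The map `∑ c_α z ^ α ↦ ∑ ψ c_α ∂ ^ (-α)` on iterated Laurent series. -/
noncomputable def ofIterLaurent {k : Type v} [Field k] (ψ : k →+* R.constants) :
    (j : ℕ) → (h : j ≤ n) → PseudoDiff.IterLaurent k j →+* (R.iter j h).constants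
  | 0, _ => ψ
  | j + 1, h =>
    ofLaurent (K := PseudoDiff.IterLaurent k j) (R.iter j (Nat.le_of_succ_le h)) ⟨j, h⟩
      (ofIterLaurent ψ j (Nat.le_of_succ_le h))

theorem ofIterLaurent_surjective {k : Type v} [Field k] {ψ : k →+* R.constants}
    (hψ : Function.Surjective ψ) (j : ℕ) (h : j ≤ n) :
    Function.Surjective (R.ofIterLaurent ψ j h) := by
  induction j with
  | zero => exact hψ
  | succ j ih =>
    exact ofLaurent_surjective (K := PseudoDiff.IterLaurent k j) (R.iter j (Nat.le_of_succ_le h))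
      ⟨j, h⟩ _ (ih (Nat.le_of_succ_le h))

variable {R}

theorem monomial_mem_constants {a : R.carrier} (ha : a ∈ R.constants) (j : ℕ) (h : j ≤ n)
    (α : Fin j → ℤ) : R.monomial j h α a ∈ (R.iter j h).constants := by
  induction j with
  | zero => exact ha
  | succ j ih => exact single_mem_constants _ (ih _ _) _

theorem monomial_zero_one (j : ℕ) (h : j ≤ n) : R.monomial j h 0 1 = 1 := by
  induction j with
  | zero => rfl
  | succ j ih => exact congrArg (PsDO.single 0) (ih (Nat.le_of_succ_le h))

theorem monomial_mul_monomial (j : ℕ) (h : j ≤ n) (α β : Fin j → ℤ) (a : R.carrier)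
    {b : R.carrier} (hb : b ∈ R.constants) :
    R.monomial j h α a * R.monomial j h β b = R.monomial j h (α + β) (a * b) := by
  induction j with
  | zero => rfl
  | succ j ih =>
    exact (PsDO.single_mul_single_of_der_eq_zero _ _ _ (monomial_mem_constants hb j _ _ _)).trans
      (congrArg (PsDO.single _) (ih _ _ _))

variable (R) in
/-- The monomials `∂ ^ α`, as a homomorphism from their exponents. -/
noncomputable def monomialHom (j : ℕ) (h : j ≤ n) :
    Multiplicative (Fin j → ℤ) →* (R.iter j h).carrier where
  toFun α := R.monomial j h α.toAdd 1
  map_one' := monomial_zero_one j h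
  map_mul' α β := by rw [monomial_mul_monomial _ _ _ _ _ R.constants.one_mem, one_mul, toAdd_mul]

theorem monomial_single_last (j : ℕ) (h : j + 1 ≤ n) :
    R.monomial (j + 1) h (Pi.single (Fin.last j) 1) 1 =
      PsDO.single (d := (R.iter j (Nat.le_of_succ_le h)).der ⟨j, h⟩) 1 1 := by
  have hinit : (fun i : Fin j => (Pi.single (Fin.last j) 1 : Fin (j + 1) → ℤ) i.castSucc) = 0 :=
    funext fun i => Pi.single_eq_of_ne (Fin.castSucc_lt_last i).ne _
  rw [monomial, hinit, Pi.single_eq_same, monomial_zero_one]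

theorem monomial_single_castSucc (j : ℕ) (h : j + 1 ≤ n) (i : Fin j) :
    R.monomial (j + 1) h (Pi.single i.castSucc 1) 1 =
      PsDO.single (d := (R.iter j (Nat.le_of_succ_le h)).der ⟨j, h⟩) 0
        (R.monomial j (Nat.le_of_succ_le h) (Pi.single i 1) 1) := by
  have hinit : (fun l : Fin j => (Pi.single i.castSucc 1 : Fin (j + 1) → ℤ) l.castSucc) =
      Pi.single i 1 :=
    funext fun l => by simp only [Pi.single_apply, Fin.castSucc_inj]
  rw [monomial, hinit, Pi.single_eq_of_ne (Fin.castSucc_lt_last i).ne']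

theorem monomial_single_one_mul_sub (j : ℕ) (h : j ≤ n) (i : Fin j) (f : (R.iter j h).carrier) :
    R.monomial j h (Pi.single i 1) 1 * f - f * R.monomial j h (Pi.single i 1) 1 =
      (R.iter j h).der (Fin.castLE h i) f := by
  induction j with
  | zero => exact i.elim0
  | succ j ih =>
    induction i using Fin.lastCases with
    | last =>
      rw [monomial_single_last]
      exact PsDO.single_one_one_mul_sub f
    | cast i =>
      rw [monomial_single_castSucc]
      exact PsDO.single_zero_mul_sub ((R.iter j _).comm _ _)
        (monomial_mem_constants R.constants.one_mem j _ _ _) (ih _ i) f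

theorem monomial_zero_mul_comm {a : R.carrier} (ha : a ∈ R.constants)
    (hcomm : ∀ f, a * f = f * a) (j : ℕ) (h : j ≤ n) (f : (R.iter j h).carrier) :
    R.monomial j h 0 a * f = f * R.monomial j h 0 a := by
  induction j with
  | zero => exact hcomm f
  | succ j ih =>
    exact PsDO.single_zero_mul_comm (monomial_mem_constants ha j _ _ _) (ih _) f

theorem coeff_monomial_zero_mul (a : R.carrier) (j : ℕ) (h : j ≤ n) (f : (R.iter j h).carrier)
    (β : Fin j → ℤ) : R.coeff j h (R.monomial j h 0 a * f) β = a * R.coeff j h f β := by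
  induction j with
  | zero => rfl
  | succ j ih =>
    refine Eq.trans ?_ (ih (Nat.le_of_succ_le h) _ _)
    exact congrArg (R.coeff j _ · _) (PsDO.coeff_single_zero_mul _ f _)

end Iter

end DiffRing

universe w

/-- `P F X` expresses that the family `F` sums to `X`, in a sense that is compatible with the ring
operations and the derivations of `R`. -/
structure IsSummation {ι : Type v} (R : DiffRing.{u} ι) {I : Type w}
    (P : (I → R.carrier) → R.carrier → Prop) : Prop where
  zero : P 0 0
  add : ∀ {F G X Y}, P F X → P G Y → P (F + G) (X + Y)
  mul_left : ∀ (a) {F X}, P F X → P (fun s => a * F s) (a * X)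
  mul_right : ∀ (a) {F X}, P F X → P (fun s => F s * a) (X * a)
  der : ∀ (i) {F X}, P F X → P (fun s => R.der i (F s)) (R.der i X)

namespace IsSummation

variable {ι : Type v} {R : DiffRing.{u} ι} {I : Type w} {P : (I → R.carrier) → R.carrier → Prop}

theorem sum (hP : IsSummation R P) {κ : Type*} (s : Finset κ) {F : κ → I → R.carrier}
    {X : κ → R.carrier} (h : ∀ q, P (F q) (X q)) :
    P (fun a => ∑ q ∈ s, F q a) (∑ q ∈ s, X q) := by
  classical
  induction s using Finset.induction_on with
  | empty => exact hP.zero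
  | insert q s hq ih =>
    simp only [Finset.sum_insert hq]
    exact hP.add (h q) ih

theorem zsmul (hP : IsSummation R P) (m : ℤ) {F : I → R.carrier} {X : R.carrier} (h : P F X) :
    P (fun a => m • F a) (m • X) := by
  simpa only [zsmul_eq_mul] using hP.mul_left (m : R.carrier) h

theorem iterate_der (hP : IsSummation R P) (i : ι) (q : ℕ) {F : I → R.carrier} {X : R.carrier}
    (h : P F X) : P (fun a => (R.der i)^[q] (F a)) ((R.der i)^[q] X) := by
  induction q with
  | zero => exact h
  | succ q ih => simpa only [Function.iterate_succ_apply'] using hP.der i ih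

variable (R I) in
theorem finsum :
    IsSummation R fun (F : I → R.carrier) X => (Function.support F).Finite ∧ X = ∑ᶠ s, F s where
  zero := ⟨by simp, by simp⟩
  add := by
    rintro F G X Y ⟨hF, rfl⟩ ⟨hG, rfl⟩
    exact ⟨(hF.union hG).subset (Function.support_add F G), (finsum_add_distrib hF hG).symm⟩
  mul_left := by
    rintro a F X ⟨hF, rfl⟩
    exact ⟨hF.subset fun s hs h => hs (by simp [h]), mul_finsum' _ _ hF⟩
  mul_right := by
    rintro a F X ⟨hF, rfl⟩
    exact ⟨hF.subset fun s hs h => hs (by simp [h]), finsum_mul' _ _ hF⟩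
  der := by
    rintro i F X ⟨hF, rfl⟩
    exact ⟨hF.subset fun s hs h => hs (by simp [h]),
      AddMonoidHom.map_finsum (R.der i).toAddMonoidHom hF⟩

end IsSummation

namespace PsDO

variable {A : Type u} [Ring A] {d : RingDer A}

/-- Coefficientwise summation of families of uniformly bounded order. -/
def SumsTo {I : Type w} (P : (I → A) → A → Prop) (F : I → PsDO d) (X : PsDO d) : Prop :=
  (∃ N, (∀ s, F s ∈ ordLE d N) ∧ X ∈ ordLE d N) ∧ ∀ m, P (fun s => (F s).coeff m) (X.coeff m)

/-- The ranges of summation depend on `f` and `g` only through the bounds for their orders. -/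
theorem coeff_mul_eq_sum {f g : PsDO d} {N M : ℤ} (hf : f ∈ ordLE d N) (hg : g ∈ ordLE d M)
    (m : ℤ) : (f * g).coeff m = ∑ p ∈ (Finset.Icc (m - M) N) ×ˢ
      (Finset.range (M - m + N + 1).toNat),
        Ring.choose p.1 p.2 • (f.coeff p.1 * d^[p.2] (g.coeff (m - p.1 + p.2))) := by
  rw [coeff_mul]
  refine finsum_eq_sum_of_support_subset _ fun p hp => ?_
  have hN : p.1 ≤ N := by
    by_contra h
    exact hp (by simp [hf p.1 (not_le.mp h)])
  have hM : m - p.1 + p.2 ≤ M := by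
    by_contra h
    exact hp (by simp [hg _ (not_le.mp h)])
  simp only [Finset.coe_product, Set.mem_prod, Finset.coe_Icc, Set.mem_Icc, Finset.coe_range,
    Set.mem_Iio]
  omega

theorem single_zero (i : ℤ) : (single i 0 : PsDO d) = 0 := ext fun _ => ite_self 0

end PsDO

theorem IsSummation.psdo {ι : Type v} {R : DiffRing.{u} ι} {I : Type w}
    {P : (I → R.carrier) → R.carrier → Prop} (hP : IsSummation R P) (l : ι) :
    IsSummation (R.psdo l) (PsDO.SumsTo (d := R.der l) P) where
  zero := ⟨⟨0, fun _ => zero_mem _, zero_mem _⟩, fun _ => hP.zero⟩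
  add := by
    rintro F G X Y ⟨⟨N, hFN, hXN⟩, hF⟩ ⟨⟨M, hGM, hYM⟩, hG⟩
    have hN := PsDO.ordLE_mono (d := R.der l) (le_max_left N M)
    have hM := PsDO.ordLE_mono (d := R.der l) (le_max_right N M)
    exact ⟨⟨max N M, fun s => add_mem (hN (hFN s)) (hM (hGM s)), add_mem (hN hXN) (hM hYM)⟩,
      fun m => hP.add (hF m) (hG m)⟩
  mul_left := by
    rintro f F X ⟨⟨M, hFM, hXM⟩, hF⟩
    obtain ⟨N, hN⟩ := PsDO.exists_mem_ordLE (d := R.der l) f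
    refine ⟨⟨N + M, fun s => PsDO.mul_mem_ordLE hN (hFM s), PsDO.mul_mem_ordLE hN hXM⟩,
      fun m => ?_⟩
    exact (congrArg₂ P (funext fun s => PsDO.coeff_mul_eq_sum hN (hFM s) m)
      (PsDO.coeff_mul_eq_sum hN hXM m)).mpr <| hP.sum _ fun p : ℤ × ℕ =>
        hP.zsmul _ (hP.mul_left _ (hP.iterate_der l _ (hF _)))
  mul_right := by
    rintro f F X ⟨⟨M, hFM, hXM⟩, hF⟩
    obtain ⟨N, hN⟩ := PsDO.exists_mem_ordLE (d := R.der l) f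
    refine ⟨⟨M + N, fun s => PsDO.mul_mem_ordLE (hFM s) hN, PsDO.mul_mem_ordLE hXM hN⟩,
      fun m => ?_⟩
    exact (congrArg₂ P (funext fun s => PsDO.coeff_mul_eq_sum (hFM s) hN m)
      (PsDO.coeff_mul_eq_sum hXM hN m)).mpr <| hP.sum _ fun p : ℤ × ℕ =>
        hP.zsmul _ (hP.mul_right _ (hF _))
  der := by
    rintro i F X ⟨⟨M, hFM, hXM⟩, hF⟩
    exact ⟨⟨M, fun s => PsDO.extendDer_mem_ordLE (R.comm i l) (hFM s),
      PsDO.extendDer_mem_ordLE (R.comm i l) hXM⟩, fun m => hP.der i (hF m)⟩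

theorem PseudoDiff.laurentCoeff_zero {k : Type u} [Field k] : (j : ℕ) → (α : Fin j → ℤ) →
    PseudoDiff.laurentCoeff j (0 : PseudoDiff.IterLaurent k j) α = 0
  | 0, _ => rfl
  | j + 1, _ => PseudoDiff.laurentCoeff_zero j _

namespace DiffRing

variable {n : ℕ} (R : DiffRing.{u} (Fin n)) {I : Type w}

/-- Summation of families in `R((∂₁⁻¹))…((∂ⱼ⁻¹))`, coefficientwise and, at each stage, with
uniformly bounded orders. -/
def SumsTo : (j : ℕ) → (h : j ≤ n) → (I → (R.iter j h).carrier) → (R.iter j h).carrier → Prop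
  | 0, _ => fun (F : I → R.carrier) X => (Function.support F).Finite ∧ X = ∑ᶠ s, F s
  | j + 1, h => PsDO.SumsTo (d := (R.iter j (Nat.le_of_succ_le h)).der ⟨j, h⟩)
      (SumsTo j (Nat.le_of_succ_le h))

variable (I) in
theorem isSummation_sumsTo (j : ℕ) (h : j ≤ n) :
    IsSummation (R.iter j h) (R.SumsTo (I := I) j h) := by
  induction j with
  | zero => exact IsSummation.finsum R I
  | succ j ih => exact (ih (Nat.le_of_succ_le h)).psdo ⟨j, h⟩

variable {R}

theorem SumsTo.of_comp_injective {I' : Type*} {e : I' → I} (he : Function.Injective e) (j : ℕ)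
    (h : j ≤ n) {F : I → (R.iter j h).carrier} {X : (R.iter j h).carrier}
    (h0 : ∀ s, s ∉ Set.range e → F s = 0) (hF : R.SumsTo j h (F ∘ e) X) : R.SumsTo j h F X := by
  induction j with
  | zero =>
    refine ⟨(hF.1.image e).subset fun s hs => ?_, hF.2.trans (finsum_eq_comp F e he h0).symm⟩
    obtain ⟨t, rfl⟩ : s ∈ Set.range e := not_imp_comm.mp (h0 s) hs
    exact ⟨t, hs, rfl⟩
  | succ j ih =>
    obtain ⟨⟨N, hFN, hXN⟩, hF⟩ := hF
    refine ⟨⟨N, fun s => ?_, hXN⟩, fun m => ?_⟩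
    · by_cases hs : s ∈ Set.range e
      · obtain ⟨t, rfl⟩ := hs
        exact hFN t
      · rw [h0 s hs]
        exact zero_mem _
    · exact ih (Nat.le_of_succ_le h) (fun s hs => by rw [h0 s hs]; rfl) (hF m)

theorem SumsTo.coeff (j : ℕ) (h : j ≤ n) {F : I → (R.iter j h).carrier}
    {X : (R.iter j h).carrier} (hF : R.SumsTo j h F X) (β : Fin j → ℤ) :
    {s | R.coeff j h (F s) β ≠ 0}.Finite ∧ R.coeff j h X β = ∑ᶠ s, R.coeff j h (F s) β := by
  induction j with
  | zero => exact hF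
  | succ j ih => exact ih (Nat.le_of_succ_le h) (hF.2 (β (Fin.last j))) _

theorem coeff_ext (j : ℕ) (h : j ≤ n) {X Y : (R.iter j h).carrier}
    (hXY : ∀ β, R.coeff j h X β = R.coeff j h Y β) : X = Y := by
  induction j with
  | zero => exact hXY 0
  | succ j ih =>
    refine PsDO.ext (d := (R.iter j (Nat.le_of_succ_le h)).der ⟨j, h⟩) fun m =>
      ih (Nat.le_of_succ_le h) fun β => ?_
    simpa only [DiffRing.coeff, Fin.snoc_last, Fin.snoc_castSucc] using hXY (Fin.snoc β m)

theorem sumsTo_single_snoc (j : ℕ) (h : j + 1 ≤ n) {N : ℤ}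
    {G : ℤ → (Fin j → ℤ) → (R.iter j (Nat.le_of_succ_le h)).carrier}
    {X : PsDO ((R.iter j (Nat.le_of_succ_le h)).der ⟨j, h⟩)} (hG : ∀ m < N, G m = 0)
    (hX : ∀ m, R.SumsTo j (Nat.le_of_succ_le h) (G m) (X.coeff (-m))) :
    R.SumsTo (j + 1) h (fun α : Fin (j + 1) → ℤ =>
      PsDO.single (d := (R.iter j (Nat.le_of_succ_le h)).der ⟨j, h⟩)
        (-α (Fin.last j)) (G (α (Fin.last j)) fun i => α i.castSucc)) X := by
  obtain ⟨M, hM⟩ := X.exists_mem_ordLE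
  refine ⟨⟨max (-N) M, fun α => ?_, PsDO.ordLE_mono (le_max_right _ _) hM⟩, fun m => ?_⟩
  · rcases lt_or_ge (α (Fin.last j)) N with hα | hα
    · simp only [hG _ hα, Pi.zero_apply, PsDO.single_zero]
      exact zero_mem _
    · exact PsDO.ordLE_mono (le_max_of_le_left (neg_le_neg hα)) (PsDO.single_mem_ordLE _ _)
  · have hsnoc : Function.Injective fun β : Fin j → ℤ => (Fin.snoc β (-m) : Fin (j + 1) → ℤ) :=
      fun β γ hβγ => (Fin.snoc_inj.mp hβγ).1
    refine SumsTo.of_comp_injective hsnoc j _ (fun α hα => if_neg fun hm => hα ?_) ?_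
    · refine ⟨fun i => α i.castSucc, ?_⟩
      rw [hm, neg_neg]
      exact Fin.snoc_init_self α
    · convert hX (-m) using 1
      · funext β
        simp [PsDO.coeff_single]
      · rw [neg_neg]

theorem monomial_zero_right (j : ℕ) (h : j ≤ n) (α : Fin j → ℤ) : R.monomial j h α 0 = 0 := by
  induction j with
  | zero => rfl
  | succ j ih => exact (congrArg (PsDO.single _) (ih _ _)).trans (PsDO.single_zero _)

theorem sumsTo_ofIterLaurent {k : Type v} [Field k] (ψ : k →+* R.constants) (j : ℕ) (h : j ≤ n)
    (c : PseudoDiff.IterLaurent k j) :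
    R.SumsTo j h (fun α => R.monomial j h (-α) (ψ (PseudoDiff.laurentCoeff j c α)))
      (R.ofIterLaurent ψ j h c) := by
  induction j with
  | zero => exact ⟨Set.toFinite _, (finsum_unique fun _ : Fin 0 → ℤ => (ψ c : R.carrier)).symm⟩
  | succ j ih =>
    let c' : LaurentSeries (PseudoDiff.IterLaurent k j) := c
    refine sumsTo_single_snoc j h (N := c'.order) (G := fun m β =>
      R.monomial j _ (-β) (ψ (PseudoDiff.laurentCoeff j (HahnSeries.coeff c' m) β)))
      (fun m hm => funext fun β => ?_) fun m => ?_
    · rw [HahnSeries.coeff_eq_zero_of_lt_order hm, PseudoDiff.laurentCoeff_zero, map_zero,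
        ZeroMemClass.coe_zero, monomial_zero_right, Pi.zero_apply]
    · convert ih (Nat.le_of_succ_le h) (HahnSeries.coeff c' m) using 1
      change (R.ofIterLaurent ψ j (Nat.le_of_succ_le h) (HahnSeries.coeff c' (- -m)) :
        (R.iter j (Nat.le_of_succ_le h)).carrier) = _
      rw [neg_neg]

end DiffRing

section PowerSeries

variable {k : Type u} [Field k] {σ : Type v}

/-- The Euler homotopy: the form `∑ⱼ bⱼ dxⱼ` is sent to `∑ⱼ xⱼ bⱼ` with the coefficient of each
monomial divided by its total degree; division by zero makes the constant coefficient `0`. -/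
noncomputable def eulerHomotopy : (σ → MvPowerSeries σ k) →+ MvPowerSeries σ k where
  toFun b m := (∑ j ∈ m.support, MvPowerSeries.coeff (m - Finsupp.single j 1) (b j)) / m.degree
  map_zero' := funext fun m => by
    simp only [Pi.zero_apply, map_zero, Finset.sum_const_zero, zero_div]
    rfl
  map_add' b c := funext fun m => by
    simp only [Pi.add_apply, map_add, Finset.sum_add_distrib, add_div]
    rfl

theorem coeff_eulerHomotopy (b : σ → MvPowerSeries σ k) (m : σ →₀ ℕ) :
    MvPowerSeries.coeff m (eulerHomotopy b) =
      (∑ j ∈ m.support, MvPowerSeries.coeff (m - Finsupp.single j 1) (b j)) / m.degree :=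
  rfl

theorem exists_eq_add_single {m : σ →₀ ℕ} {i : σ} (hi : m i ≠ 0) :
    ∃ p, m = p + Finsupp.single i 1 :=
  ⟨m - Finsupp.single i 1, (tsub_add_cancel_of_le <|
    Finsupp.single_le_iff.mpr (Nat.one_le_iff_ne_zero.mpr hi)).symm⟩

theorem coeff_mul_eq_mul_coeff_of_closed {b : σ → MvPowerSeries σ k}
    (hb : ∀ i j, MvPowerSeries.pderiv k i (b j) = MvPowerSeries.pderiv k j (b i)) {m : σ →₀ ℕ}
    {i j : σ} (hj : (m + Finsupp.single i 1 : σ →₀ ℕ) j ≠ 0) :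
    MvPowerSeries.coeff (m + Finsupp.single i 1 - Finsupp.single j 1) (b j) * (m i + 1) =
      (m + Finsupp.single i 1 : σ →₀ ℕ) j * MvPowerSeries.coeff m (b i) := by
  classical
  by_cases hij : j = i
  · subst hij
    simp [mul_comm]
  · obtain ⟨p, rfl⟩ : ∃ p, m = p + Finsupp.single j 1 :=
      exists_eq_add_single (by simpa [Finsupp.single_apply, Ne.symm hij] using hj)
    have hp := congrArg (MvPowerSeries.coeff p) (hb i j)
    rw [MvPowerSeries.coeff_pderiv, MvPowerSeries.coeff_pderiv] at hp
    rw [add_right_comm, add_tsub_cancel_right]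
    simpa [Finsupp.single_apply, hij, Ne.symm hij, mul_comm] using hp

variable [CharZero k]

theorem pderiv_eulerHomotopy {b : σ → MvPowerSeries σ k}
    (hb : ∀ i j, MvPowerSeries.pderiv k i (b j) = MvPowerSeries.pderiv k j (b i)) (i : σ) :
    MvPowerSeries.pderiv k i (eulerHomotopy b) = b i := by
  ext m
  have hdeg : ((m + Finsupp.single i 1).degree : k) ≠ 0 := by
    rw [map_add, Finsupp.degree_single]
    exact Nat.cast_ne_zero.mpr (Nat.succ_ne_zero _)
  rw [MvPowerSeries.coeff_pderiv, coeff_eulerHomotopy, div_mul_eq_mul_div, div_eq_iff hdeg,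
    Finset.sum_mul, Finset.sum_congr rfl fun j hj =>
      coeff_mul_eq_mul_coeff_of_closed hb (Finsupp.mem_support_iff.mp hj),
    ← Finset.sum_mul, ← Nat.cast_sum, mul_comm]
  rfl

theorem eq_C_of_pderiv_eq_zero {f : MvPowerSeries σ k}
    (hf : ∀ i, MvPowerSeries.pderiv k i f = 0) :
    f = MvPowerSeries.C (MvPowerSeries.coeff 0 f) := by
  classical
  ext m
  rw [MvPowerSeries.coeff_C]
  split_ifs with hm
  · rw [hm]
  obtain ⟨i, hi⟩ := Finsupp.ne_iff.mp hm
  obtain ⟨p, rfl⟩ := exists_eq_add_single hi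
  have hp := congrArg (MvPowerSeries.coeff p) (hf i)
  rw [MvPowerSeries.coeff_pderiv, map_zero] at hp
  exact (mul_eq_zero.mp hp).resolve_right (Nat.cast_add_one_ne_zero _)

end PowerSeries

namespace DiffRing

variable (k : Type u) [Field k] (n : ℕ)

theorem isAntiderivative_eulerHomotopy [CharZero k] :
    (powerSeries k n).IsAntiderivative (eulerHomotopy (k := k) (σ := Fin n)) :=
  fun _ hb => pderiv_eulerHomotopy hb

theorem exists_isAntiderivative_iter {R : DiffRing.{u} (Fin n)}
    (hR : ∃ J, R.IsAntiderivative J) (j : ℕ) (h : j ≤ n) :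
    ∃ J, (R.iter j h).IsAntiderivative J := by
  induction j with
  | zero => exact hR
  | succ j ih =>
    obtain ⟨J, hJ⟩ := ih (Nat.le_of_succ_le h)
    exact ⟨_, hJ.psdo ⟨j, h⟩⟩

/-- The scalars, as constants of `k[[x₁, …, xₙ]]`. -/
noncomputable def scalars : k →+* (powerSeries k n).constants :=
  RingHom.codRestrict (S := MvPowerSeries (Fin n) k) MvPowerSeries.C (powerSeries k n).constants
    fun _ _ => MvPowerSeries.pderiv_C

theorem scalars_surjective [CharZero k] : Function.Surjective (scalars k n) := fun f =>
  ⟨MvPowerSeries.coeff (R := k) 0 f.1, Subtype.ext (eq_C_of_pderiv_eq_zero f.2).symm⟩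

end DiffRing

theorem conj_mul_comm_iff {M : Type*} [Monoid M] (S : Mˣ) (a b : M) :
    S * a * ↑S⁻¹ * b = b * (S * a * ↑S⁻¹) ↔ a * (↑S⁻¹ * b * S) = ↑S⁻¹ * b * S * a := by
  rw [← Units.mul_right_inj S⁻¹, ← Units.mul_left_inj S]
  simp only [mul_assoc, Units.inv_mul_cancel_left, Units.inv_mul, mul_one]

namespace PseudoDiff

variable {k : Type u} [Field k] {n : ℕ}

theorem ext {X Y : E k n} (h : ∀ β, coeff X β = coeff Y β) : X = Y :=
  DiffRing.coeff_ext n le_rfl h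

theorem IsLaurentSum.unique {U : Fin n → (E k n)ˣ} {c : IterLaurent k n} {X Y : E k n}
    (hX : IsLaurentSum U c X) (hY : IsLaurentSum U c Y) : X = Y :=
  ext fun β => (hX β).2.trans (hY β).2.symm

theorem del_mul_sub (i : Fin n) (f : E k n) :
    del i * f - f * del i = ((DiffRing.powerSeries k n).iter n le_rfl).der i f :=
  DiffRing.monomial_single_one_mul_sub n le_rfl i f

theorem del_mem_constants (i : Fin n) :
    del i ∈ ((DiffRing.powerSeries k n).iter n le_rfl).constants :=
  DiffRing.monomial_mem_constants (DiffRing.powerSeries k n).constants.one_mem n le_rfl _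

theorem mem_constants_iff {f : E k n} :
    f ∈ ((DiffRing.powerSeries k n).iter n le_rfl).constants ↔
      f ∈ Subring.centralizer (Set.range (del (k := k) (n := n))) := by
  rw [Subring.mem_centralizer_iff, Set.forall_mem_range]
  exact forall_congr' fun i => by rw [← del_mul_sub]; exact sub_eq_zero

theorem del_comm (i j : Fin n) : (del i * del j : E k n) = del j * del i :=
  Subring.mem_centralizer_iff.mp (mem_constants_iff.mp (del_mem_constants j)) _ ⟨i, rfl⟩

variable (k n) in
/-- The substitution `zᵢ ↦ ∂ᵢ⁻¹`. -/
noncomputable def ofLaurent : IterLaurent k n →+* E k n :=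
  ((DiffRing.powerSeries k n).iter n le_rfl).constants.subtype.comp
    ((DiffRing.powerSeries k n).ofIterLaurent (DiffRing.scalars k n) n le_rfl)

theorem range_ofLaurent [CharZero k] :
    (ofLaurent k n).range = Subring.centralizer (Set.range del) := by
  ext f
  rw [← mem_constants_iff]
  constructor
  · rintro ⟨c, rfl⟩
    exact Subtype.property _
  · intro hf
    obtain ⟨c, hc⟩ := DiffRing.ofIterLaurent_surjective _ (DiffRing.scalars_surjective k n) n le_rfl
      ⟨f, hf⟩
    exact ⟨c, congrArg Subtype.val hc⟩

theorem exists_conjugation [CharZero k] {L : Fin (n + 1) → E k (n + 1)}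
    (hL : ∀ i, L i - del i ∈ EMinus k n) (hcomm : ∀ i j, L i * L j = L j * L i) :
    ∃ S : (E k (n + 1))ˣ, ∀ i, L i * S = S * (del i : E k (n + 1)) := by
  obtain ⟨J, hJ⟩ := DiffRing.exists_isAntiderivative_iter (n + 1)
    ⟨_, DiffRing.isAntiderivative_eulerHomotopy k (n + 1)⟩ n n.le_succ
  exact hJ.exists_conjugation (l := Fin.last n) del_mul_sub del_comm
    (fun i m hm => hL i m (by omega)) hcomm

/-- The operator `a ∂₁ ^ α₁ ⋯ ∂ₙ ^ αₙ` in `E`. -/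
noncomputable def monomial (α : Fin n → ℤ) (a : MvPowerSeries (Fin n) k) : E k n :=
  (DiffRing.powerSeries k n).monomial n le_rfl α a

theorem monomial_zero_mul_monomial_one (a : MvPowerSeries (Fin n) k) (α : Fin n → ℤ) :
    monomial 0 a * monomial α 1 = monomial α a :=
  (DiffRing.monomial_mul_monomial n le_rfl 0 α _
    (DiffRing.powerSeries k n).constants.one_mem).trans
    (congrArg₂ monomial (zero_add α) (mul_one a))

theorem commute_monomial_zero_C (a : k) (f : E k n) :
    Commute (monomial 0 (MvPowerSeries.C a)) f :=
  DiffRing.monomial_zero_mul_comm (DiffRing.scalars k n a).2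
    (mul_comm (G := MvPowerSeries (Fin n) k) _) n le_rfl f

theorem coeff_monomial_zero_mul (a : MvPowerSeries (Fin n) k) (f : E k n) (β : Fin n → ℤ) :
    coeff (monomial 0 a * f) β = a * coeff f β :=
  DiffRing.coeff_monomial_zero_mul (R := DiffRing.powerSeries k n) a n le_rfl f β

variable (k n) in
/-- The monomials `∂ ^ α`, as units. -/
noncomputable def delHom : Multiplicative (Fin n → ℤ) →* (E k n)ˣ :=
  ((DiffRing.powerSeries k n).monomialHom n le_rfl).toHomUnits

/-- The unit `S ∂ᵢ S⁻¹`. -/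
noncomputable def conjDel (S : (E k n)ˣ) (i : Fin n) : (E k n)ˣ :=
  MulAut.conj S (delHom k n (Multiplicative.ofAdd (Pi.single i 1)))

theorem coe_conjDel (S : (E k n)ˣ) (i : Fin n) :
    (conjDel S i : E k n) = S * (del i : E k n) * ↑S⁻¹ :=
  rfl

theorem zpowProd_map_single (G : Multiplicative (Fin n → ℤ) →* (E k n)ˣ) (α : Fin n → ℤ) :
    zpowProd (fun i => G (Multiplicative.ofAdd (Pi.single i 1))) α =
      G (Multiplicative.ofAdd α) := by
  have hα : Multiplicative.ofAdd α =
      (List.ofFn fun i => Multiplicative.ofAdd (Pi.single i 1 : Fin n → ℤ) ^ α i).prod := by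
    rw [List.prod_ofFn]
    apply Multiplicative.toAdd.injective
    simp only [toAdd_prod, toAdd_zpow, toAdd_ofAdd, ← Pi.single_smul', smul_eq_mul, mul_one]
    exact (Finset.univ_sum_single α).symm
  rw [hα, map_list_prod, List.map_ofFn, zpowProd]
  simp only [Function.comp_def, map_zpow]

theorem coe_zpowProd_conjDel (S : (E k n)ˣ) (α : Fin n → ℤ) :
    (zpowProd (conjDel S) α : E k n) = S * (monomial α 1 : E k n) * ↑S⁻¹ :=
  congrArg Units.val (zpowProd_map_single ((MulAut.conj S).toMonoidHom.comp (delHom k n)) α)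

theorem coeff_conj_monomial_C (S : (E k n)ˣ) (a : k) (α β : Fin n → ℤ) :
    coeff (S * monomial α (MvPowerSeries.C a) * ↑S⁻¹ : E k n) β =
      a • coeff (zpowProd (conjDel S) α : E k n) β := by
  rw [coe_zpowProd_conjDel, ← monomial_zero_mul_monomial_one, ← mul_assoc,
    ← (commute_monomial_zero_C a _).eq, mul_assoc, mul_assoc, coeff_monomial_zero_mul,
    ← mul_assoc, MvPowerSeries.smul_eq_C_mul]

/-- The substitution `zᵢ ↦ S ∂ᵢ⁻¹ S⁻¹`. -/
noncomputable def conjLaurent (S : (E k n)ˣ) : IterLaurent k n →+* E k n :=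
  (MulSemiringAction.toRingHom (ConjAct (E k n)ˣ) (E k n) (ConjAct.toConjAct S)).comp
    (ofLaurent k n)

theorem conjLaurent_apply (S : (E k n)ˣ) (c : IterLaurent k n) :
    conjLaurent S c = (S : E k n) * ofLaurent k n c * ↑S⁻¹ :=
  rfl

theorem isLaurentSum_conjLaurent (S : (E k n)ˣ) (c : IterLaurent k n) :
    IsLaurentSum (conjDel S) c (conjLaurent S c) := by
  intro β
  have hP := (DiffRing.powerSeries k n).isSummation_sumsTo (Fin n → ℤ) n le_rfl
  simp only [← coeff_conj_monomial_C]
  exact DiffRing.SumsTo.coeff n le_rfl (hP.mul_right _ (hP.mul_left _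
    (DiffRing.sumsTo_ofIterLaurent (DiffRing.scalars k n) n le_rfl c))) β

theorem laurentIn_conjDel (S : (E k n)ˣ) : laurentIn (conjDel S) = Set.range (conjLaurent S) :=
  Set.ext fun _ =>
    ⟨fun ⟨c, hc⟩ => ⟨c, (isLaurentSum_conjLaurent S c).unique hc⟩,
      fun ⟨c, hc⟩ => ⟨c, hc ▸ isLaurentSum_conjLaurent S c⟩⟩

theorem centralizer_conjDel [CharZero k] (S : (E k n)ˣ) :
    (Subring.centralizer (Set.range fun i => (conjDel S i : E k n)) : Set (E k n)) =
      Set.range (conjLaurent S) := by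
  ext X
  have hconj : X ∈ Subring.centralizer (Set.range fun i => (conjDel S i : E k n)) ↔
      ↑S⁻¹ * X * S ∈ (ofLaurent k n).range := by
    rw [range_ofLaurent, Subring.mem_centralizer_iff, Subring.mem_centralizer_iff,
      Set.forall_mem_range, Set.forall_mem_range]
    exact forall_congr' fun i => conj_mul_comm_iff S (del i) X
  refine hconj.trans (exists_congr fun c => ?_)
  rw [conjLaurent_apply, Units.mul_inv_eq_iff_eq_mul, mul_assoc, Units.eq_inv_mul_iff_mul_eq]

end PseudoDiff

theorem corollary1 {k : Type*} [Field k] [CharZero k] (n : ℕ)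
    (L : Fin (n + 1) → PseudoDiff.E k (n + 1))
    (hL : ∀ i, L i - PseudoDiff.del i ∈ PseudoDiff.EMinus k n)
    (hcomm : ∀ i j, L i * L j = L j * L i) :
    (∀ X ∈ Subring.centralizer (Set.range L), ∀ Y ∈ Subring.centralizer (Set.range L),
      X * Y = Y * X) ∧
    ∃ U : Fin (n + 1) → (PseudoDiff.E k (n + 1))ˣ,
      (∀ i, (U i : PseudoDiff.E k (n + 1)) = L i) ∧
      (Subring.centralizer (Set.range L) : Set (PseudoDiff.E k (n + 1))) =
        PseudoDiff.laurentIn U ∧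
      ∃ φ : PseudoDiff.IterLaurent k (n + 1) →+* PseudoDiff.E k (n + 1),
        ∀ c, PseudoDiff.IsLaurentSum U c (φ c) := by
  obtain ⟨S, hS⟩ := PseudoDiff.exists_conjugation hL hcomm
  obtain rfl : (fun i => (PseudoDiff.conjDel S i : PseudoDiff.E k (n + 1))) = L :=
    funext fun i => by rw [PseudoDiff.coe_conjDel, ← hS, Units.mul_inv_cancel_right]
  have hZ := PseudoDiff.centralizer_conjDel S
  refine ⟨fun X hX Y hY => ?_, PseudoDiff.conjDel S, fun _ => rfl,
    hZ.trans (PseudoDiff.laurentIn_conjDel S).symm, PseudoDiff.conjLaurent S,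
    PseudoDiff.isLaurentSum_conjLaurent S⟩
  obtain ⟨c, rfl⟩ := hZ.subset hX
  obtain ⟨e, rfl⟩ := hZ.subset hY
  rw [← map_mul, mul_comm, map_mul]
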